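/- Definitions. All matroids are finite, and their ground sets are subsets of a fixed totally ordered set $X$. For $w\in X$ let $\le_w$ be the cyclically shifted total order on $X$ in which the elements $\ge w$ come first, in their given order, followed by the elements $<w$, in their given order. Subsets $A,B\subseteq X$ are crossing if there are $w,y\in A$ and $x,z\in B$ with $w<_w x<_w y<_w z$, and non-crossing otherwise. A matroid $M$ of rank $r$ is a positroid if it is realized by a real matrix with $r$ rows and with columns indexed, in increasing order, by $E(M)$, all of whose maximal minors are nonnegative. The Grassmann necklace of $M$ is the family $\mathcal J(M)=(J_w)_{w\in E(M)}$, where $J_w$ is the lexicographically minimal basis of $M$ with respect to $\le_w$. For a positroid $P$, the envelope class $\Omega_P$ is the set of all matroids $M$ with $E(M)=E(P)$ and $\mathcal J(M)=\mathcal J(P)$; if $P$ is not a positroid, no matroid has $P$ as its positroid envelope and $\Omega_P=\emptyset$. Put $\lambda_M(Y)=r_M(Y)+r_M(E(M)\setminus Y)-r_M(E(M))$ for $Y\subseteq E(M)$. A $k$-separation of $M$ is a pair $(Y,E(M)\setminus Y)$ with $\min\{|Y|,|E(M)\setminus Y|\}\ge k$ and $\lambda_M(Y)<k$; $M$ is $2$-connected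 if it has no $1$-separation. If $|E(M)|,|E(N)|\ge 2$, $E(M)\cap E(N)=\{e\}$, and neither $(\{e\},E(M)\setminus\{e\})$ nor $(\{e\},E(N)\setminus\{e\})$ is a $1$-separation of $M$, respectively $N$, then the $2$-sum $M\oplus_2 N$ is defined: it is the matroid on $(E(M)\cup E(N))\setminus\{e\}$ whose circuits are the circuits of $M\setminus e$, the circuits of $N\setminus e$, and the sets $(C_1\cup C_2)\setminus\{e\}$ with $C_1$ a circuit of $M$, $C_2$ a circuit of $N$ and $e\in C_1\cap C_2$. Proposition. Let $P$ and $Q$ be $2$-connected positroids on non-crossing subsets of a totally ordered set $X$, such that $|E(P)|\ge 3$, $|E(Q)|\ge 3$ and $E(P)\cap E(Q)=\{e\}$. Then the $2$-sum $P\oplus_2 Q$ is defined, the $2$-sum $M\oplus_2 N$ is defined for all $M\in\Omega_P$ and $N\in\Omega_Q$, and $$\Omega_{P\oplus_2 Q}=\{M\oplus_2 N : M\in\Omega_P,\ N\in\Omega_Q\}.$$ -/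

import Mathlib

open Set

/-! ## Cyclic shifts of a total order, non-crossing sets -/

section Order

variable {α : Type*} [LinearOrder α]

/-- The strict order `a <_w b` of the cyclic shift of the order of `α` that starts at `w`:
first come the elements `≥ w`, in their order, then the elements `< w`, in their order. -/
def ShiftLT (w a b : α) : Prop :=
  (a < b ∧ (w ≤ a ∨ b < w)) ∨ (w ≤ a ∧ b < w)

/-- `X` and `Y` are crossing if there are `w, y ∈ X` and `x, z ∈ Y` with
`w <_w x <_w y <_w z`. -/
def Crossing (X Y : Set α) : Prop :=
  ∃ w ∈ X, ∃ x ∈ Y, ∃ y ∈ X, ∃ z ∈ Y, ShiftLT w w x ∧ ShiftLT w x y ∧ ShiftLT w y z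

/-- `X` and `Y` are non-crossing. -/
def NonCrossing (X Y : Set α) : Prop := ¬ Crossing X Y

theorem ShiftLT.trans {w a b c : α} (h : ShiftLT w a b) (h' : ShiftLT w b c) :
    ShiftLT w a c := by
  unfold ShiftLT at *
  grind

theorem shiftLT_trichotomy (w a b : α) : ShiftLT w a b ∨ a = b ∨ ShiftLT w b a := by
  unfold ShiftLT
  grind

theorem not_shiftLT_self (w a : α) : ¬ ShiftLT w a a := by
  unfold ShiftLT
  grind

/-- Lexicographic comparison of sets with respect to `<_w`: the `<_w`-first element in which
the two sets differ belongs to `A`. -/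
def LexLT (w : α) (A B : Set α) : Prop :=
  ∃ x ∈ A, x ∉ B ∧ ∀ y, ShiftLT w y x → (y ∈ A ↔ y ∈ B)

theorem LexLT.trans {w : α} {A B C : Set α} (h : LexLT w A B) (h' : LexLT w B C) :
    LexLT w A C := by
  obtain ⟨x, hxA, hxB, hx⟩ := h
  obtain ⟨y, hyB, hyC, hy⟩ := h'
  rcases shiftLT_trichotomy w x y with hxy | rfl | hxy
  · exact ⟨x, hxA, fun h => hxB ((hy x hxy).2 h),
      fun z hz => (hx z hz).trans (hy z (hz.trans hxy))⟩
  · exact absurd hyB hxB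
  · exact ⟨y, (hx y hxy).2 hyB, hyC,
      fun z hz => (hx z (hz.trans hxy)).trans (hy z hz)⟩

theorem not_lexLT_self (w : α) (A : Set α) : ¬ LexLT w A A := by
  rintro ⟨x, hx, hx', -⟩
  exact hx' hx

theorem lexLT_total {w : α} {A B : Set α} (hA : A.Finite) (hB : B.Finite) (hne : A ≠ B) :
    LexLT w A B ∨ LexLT w B A := by
  have hfin : {x | ¬ (x ∈ A ↔ x ∈ B)}.Finite := (hA.union hB).subset (by
    intro x hx
    simp only [mem_ofPred_eq] at hx
    by_contra h
    simp only [mem_union, not_or] at h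
    exact hx ⟨fun h' => absurd h' h.1, fun h' => absurd h' h.2⟩)
  have hnon : {x | ¬ (x ∈ A ↔ x ∈ B)}.Nonempty := by
    by_contra h
    rw [Set.not_nonempty_iff_eq_empty, Set.eq_empty_iff_forall_notMem] at h
    exact hne (Set.ext fun x => not_not.1 (h x))
  have : Finite {x | ¬ (x ∈ A ↔ x ∈ B)} := hfin.to_subtype
  have : IsTrans {x | ¬ (x ∈ A ↔ x ∈ B)} (fun a b => ShiftLT w a.1 b.1) :=
    ⟨fun _ _ _ => ShiftLT.trans⟩
  have : Std.Irrefl (fun a b : {x | ¬ (x ∈ A ↔ x ∈ B)} => ShiftLT w a.1 b.1) :=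
    ⟨fun a => not_shiftLT_self w a.1⟩
  obtain ⟨⟨x, hx⟩, -, hmin⟩ :=
    (Finite.wellFounded_of_trans_of_irrefl
      (fun a b : {x | ¬ (x ∈ A ↔ x ∈ B)} => ShiftLT w a.1 b.1)).has_min univ ⟨⟨_, hnon.some_mem⟩, mem_univ _⟩
  have hmin' : ∀ y, ShiftLT w y x → (y ∈ A ↔ y ∈ B) := fun y hy => by
    by_contra h
    exact hmin ⟨y, h⟩ (mem_univ _) hy
  by_cases hxA : x ∈ A
  · exact Or.inl ⟨x, hxA, fun h => hx ⟨fun _ => h, fun _ => hxA⟩, hmin'⟩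
  · exact Or.inr ⟨x, by_contra fun h => hx ⟨fun h' => absurd h' hxA, fun h' => absurd h' h⟩,
      hxA, fun y hy => (hmin' y hy).symm⟩

end Order

namespace Matroid

/-! ## Connectivity and 2-sums -/

section Sums

variable {α : Type*}

/-- The connectivity function `λ_M(X) = r(X) + r(E ∖ X) - r(M)` of a finite matroid. -/
noncomputable def connectivity (M : Matroid α) (X : Set α) : ℤ :=
  ((M.eRk X).toNat : ℤ) + ((M.eRk (M.E \ X)).toNat : ℤ) - (M.eRank.toNat : ℤ)

/-- `(X, E ∖ X)` is a `k`-separation of the finite matroid `M`. -/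
def IsSeparation (M : Matroid α) (k : ℕ) (X : Set α) : Prop :=
  X ⊆ M.E ∧ k ≤ X.ncard ∧ k ≤ (M.E \ X).ncard ∧ M.connectivity X < k

/-- `M` is `n`-connected: it has no `k`-separation for `1 ≤ k ≤ n - 1`. -/
def IsNConnected (M : Matroid α) (n : ℕ) : Prop :=
  ∀ k : ℕ, 1 ≤ k → k < n → ∀ X : Set α, ¬ M.IsSeparation k X

/-- The conditions under which the 2-sum of the finite matroids `M` and `N` with basepoint `e`
is defined. -/
structure TwoSummable (e : α) (M N : Matroid α) : Prop where
  finite_left : M.Finite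
  finite_right : N.Finite
  two_le_left : 2 ≤ M.E.ncard
  two_le_right : 2 ≤ N.E.ncard
  inter_eq : M.E ∩ N.E = {e}
  not_sep_left : ¬ M.IsSeparation 1 {e}
  not_sep_right : ¬ N.IsSeparation 1 {e}

/-- `C` belongs to the family of sets that are the circuits of the 2-sum of `M` and `N` with
basepoint `e`. -/
def IsTwoSumCircuit (e : α) (M N : Matroid α) (C : Set α) : Prop :=
  (M ＼ {e}).IsCircuit C ∨ (N ＼ {e}).IsCircuit C ∨
    ∃ C₁ C₂, M.IsCircuit C₁ ∧ N.IsCircuit C₂ ∧ e ∈ C₁ ∩ C₂ ∧ C = (C₁ ∪ C₂) \ {e}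

/-- `R` is the 2-sum of `M` and `N` with basepoint `e`. -/
def IsTwoSum (e : α) (M N R : Matroid α) : Prop :=
  R.E = (M.E ∪ N.E) \ {e} ∧ ∀ C, R.IsCircuit C ↔ IsTwoSumCircuit e M N C

open Classical in
/-- The 2-sum of `M` and `N` with basepoint `e`. By `isTwoSum_twoSum` and `IsTwoSum.eq` below it
is the unique matroid with the prescribed ground set and circuits whenever `TwoSummable e M N`. -/
noncomputable def twoSum (e : α) (M N : Matroid α) : Matroid α :=
  if h : ∃ R, IsTwoSum e M N R then h.choose else emptyOn α

theorem IsTwoSum.eq {e : α} {M N R R' : Matroid α} (h : IsTwoSum e M N R)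
    (h' : IsTwoSum e M N R') : R = R' :=
  ext_isCircuit (h.1.trans h'.1.symm) fun C _ => (h.2 C).trans (h'.2 C).symm

/-- The independent sets of the 2-sum. -/
def TwoSumIndep (e : α) (M N : Matroid α) (I : Set α) : Prop :=
  ∃ A B, M.Indep A ∧ N.Indep B ∧ ((e ∈ A ∧ e ∉ B) ∨ (e ∉ A ∧ e ∈ B)) ∧ I = (A ∪ B) \ {e}

theorem isNonloop_of_not_isSeparation {e : α} {M : Matroid α} (hM : M.Finite)
    (h2 : 2 ≤ M.E.ncard) (he : e ∈ M.E) (h : ¬ M.IsSeparation 1 {e}) : M.Indep {e} := by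
  by_contra hI
  refine h ⟨by simpa using he, by simp, ?_, ?_⟩
  · have := Set.ncard_sdiff_singleton_add_one he hM.ground_finite
    omega
  · have hl : M.IsLoop e := by
      rw [← M.not_isNonloop_iff he]
      rwa [← indep_singleton]
    have h1 : M.eRk {e} = 0 := hl.eRk_eq
    obtain ⟨B, hB⟩ := M.exists_isBase
    have heB : e ∉ B := fun h => hI (hB.indep.subset (by simpa using h))
    have h3 : M.eRk (M.E \ {e}) = M.eRank := by
      refine le_antisymm (M.eRk_le_eRank _) ?_
      rw [← hB.encard_eq_eRank, ← hB.indep.eRk_eq_encard]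
      exact M.eRk_mono (fun x hx => ⟨hB.subset_ground hx, fun h => heB (h ▸ hx)⟩)
    simp [connectivity, h1, h3]

theorem TwoSummable.indep_left {e : α} {M N : Matroid α} (h : TwoSummable e M N) :
    M.Indep {e} :=
  isNonloop_of_not_isSeparation h.finite_left h.two_le_left
    (h.inter_eq.symm ▸ mem_singleton e : e ∈ M.E ∩ N.E).1 h.not_sep_left

theorem TwoSummable.indep_right {e : α} {M N : Matroid α} (h : TwoSummable e M N) :
    N.Indep {e} :=
  isNonloop_of_not_isSeparation h.finite_right h.two_le_right
    (h.inter_eq.symm ▸ mem_singleton e : e ∈ M.E ∩ N.E).2 h.not_sep_right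

theorem TwoSumIndep.ncard {e : α} {M N : Matroid α} (h : TwoSummable e M N) {A B : Set α}
    (hA : M.Indep A) (hB : N.Indep B) (he : (e ∈ A ∧ e ∉ B) ∨ (e ∉ A ∧ e ∈ B)) :
    ((A ∪ B) \ {e}).ncard + 1 = A.ncard + B.ncard := by
  have := h.finite_left
  have := h.finite_right
  have hd : Disjoint A B := by
    rw [Set.disjoint_left]
    intro x hx hx'
    have : x ∈ M.E ∩ N.E := ⟨hA.subset_ground hx, hB.subset_ground hx'⟩
    rw [h.inter_eq] at this
    obtain rfl : x = e := this
    tauto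
  have hAf : A.Finite := M.ground_finite.subset hA.subset_ground
  have hBf : B.Finite := N.ground_finite.subset hB.subset_ground
  rw [Set.ncard_sdiff_singleton_add_one (by simp only [mem_union]; tauto) (hAf.union hBf),
    Set.ncard_union_eq hd hAf hBf]

theorem TwoSumIndep.aug {e : α} {M N : Matroid α} (h : TwoSummable e M N) {I J : Set α}
    (hI : TwoSumIndep e M N I) (hJ : TwoSumIndep e M N J) (hlt : I.ncard < J.ncard) :
    ∃ x ∈ J, x ∉ I ∧ TwoSumIndep e M N (insert x I) := by
  have := h.finite_left
  have := h.finite_right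
  obtain ⟨A', B', hA', hB', he', rfl⟩ := hJ
  have hJc := TwoSumIndep.ncard h hA' hB' he'
  -- the two ways to augment by an element other than `e`
  have keyM : ∀ A B x, M.Indep A → N.Indep B → ((e ∈ A ∧ e ∉ B) ∨ (e ∉ A ∧ e ∈ B)) →
      x ∈ A' → x ∉ A → M.Indep (insert x A) → x ≠ e → I = (A ∪ B) \ {e} →
      ∃ x ∈ (A' ∪ B') \ {e}, x ∉ I ∧ TwoSumIndep e M N (insert x I) := by
    rintro A B x hA hB he hx hxA hxI hxe rfl
    refine ⟨x, ⟨Or.inl hx, hxe⟩, ?_, insert x A, B, hxI, hB, ?_, ?_⟩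
    · rintro ⟨hx' | hx', -⟩
      · exact hxA hx'
      · have : x ∈ M.E ∩ N.E := ⟨hA'.subset_ground hx, hB.subset_ground hx'⟩
        rw [h.inter_eq] at this
        exact hxe this
    · simp only [mem_insert_iff, hxe.symm, false_or]; exact he
    · rw [insert_union, insert_sdiff_of_notMem _ (by simpa using hxe)]
  have keyN : ∀ A B x, M.Indep A → N.Indep B → ((e ∈ A ∧ e ∉ B) ∨ (e ∉ A ∧ e ∈ B)) →
      x ∈ B' → x ∉ B → N.Indep (insert x B) → x ≠ e → I = (A ∪ B) \ {e} →
      ∃ x ∈ (A' ∪ B') \ {e}, x ∉ I ∧ TwoSumIndep e M N (insert x I) := by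
    rintro A B x hA hB he hx hxB hxI hxe rfl
    refine ⟨x, ⟨Or.inr hx, hxe⟩, ?_, A, insert x B, hA, hxI, ?_, ?_⟩
    · rintro ⟨hx' | hx', -⟩
      · have : x ∈ M.E ∩ N.E := ⟨hA.subset_ground hx', hB'.subset_ground hx⟩
        rw [h.inter_eq] at this
        exact hxe this
      · exact hxB hx'
    · simp only [mem_insert_iff, hxe.symm, false_or]; exact he
    · rw [union_insert, insert_sdiff_of_notMem _ (by simpa using hxe)]
  have augM : ∀ A, M.Indep A → A.ncard < A'.ncard → ∃ x ∈ A', x ∉ A ∧ M.Indep (insert x A) := by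
    intro A hA hc
    have hAf : A.Finite := M.ground_finite.subset hA.subset_ground
    have hAf' : A'.Finite := M.ground_finite.subset hA'.subset_ground
    obtain ⟨x, hx, hxI⟩ := hA.augment hA' (by
      rw [← hAf.cast_ncard_eq, ← hAf'.cast_ncard_eq]; exact_mod_cast hc)
    exact ⟨x, hx.1, hx.2, hxI⟩
  have augN : ∀ B, N.Indep B → B.ncard < B'.ncard → ∃ x ∈ B', x ∉ B ∧ N.Indep (insert x B) := by
    intro B hB hc
    have hBf : B.Finite := N.ground_finite.subset hB.subset_ground
    have hBf' : B'.Finite := N.ground_finite.subset hB'.subset_ground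
    obtain ⟨x, hx, hxI⟩ := hB.augment hB' (by
      rw [← hBf.cast_ncard_eq, ← hBf'.cast_ncard_eq]; exact_mod_cast hc)
    exact ⟨x, hx.1, hx.2, hxI⟩
  obtain ⟨A, B, hA, hB, he, hIe⟩ := hI
  have hIc := TwoSumIndep.ncard h hA hB he
  rw [← hIe] at hIc
  have hAf : A.Finite := M.ground_finite.subset hA.subset_ground
  have hBf : B.Finite := N.ground_finite.subset hB.subset_ground
  by_cases hc : A.ncard < A'.ncard
  · obtain ⟨x, hx, hxA, hxI⟩ := augM A hA hc
    by_cases hxe : x = e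
    · subst hxe
      have hxB : x ∈ B := by tauto
      have hxB' : x ∉ B' := by tauto
      have hBd : N.Indep (B \ {x}) := hB.subset sdiff_subset
      have c1 : (insert x A).ncard = A.ncard + 1 := Set.ncard_insert_of_notMem hxA hAf
      have c2 : (B \ {x}).ncard + 1 = B.ncard := Set.ncard_sdiff_singleton_add_one hxB hBf
      have heq : I = (insert x A ∪ B \ {x}) \ {x} := by
        rw [hIe]; ext y; by_cases hy : y = x <;> simp [hy]
      have hex : (x ∈ insert x A ∧ x ∉ B \ {x}) ∨ (x ∉ insert x A ∧ x ∈ B \ {x}) := by simp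
      by_cases hc' : (insert x A).ncard < A'.ncard
      · obtain ⟨y, hy, hyA, hyI⟩ := augM _ hxI hc'
        exact keyM _ _ y hxI hBd hex hy hyA hyI (fun h => hyA (by simp [h])) heq
      · obtain ⟨y, hy, hyB, hyI⟩ := augN _ hBd (by omega)
        exact keyN _ _ y hxI hBd hex hy hyB hyI (fun h => hxB' (h ▸ hy)) heq
    · exact keyM A B x hA hB he hx hxA hxI hxe hIe
  · obtain ⟨x, hx, hxB, hxI⟩ := augN B hB (by omega)
    by_cases hxe : x = e
    · subst hxe
      have hxA : x ∈ A := by tauto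
      have hxA' : x ∉ A' := by tauto
      have hAd : M.Indep (A \ {x}) := hA.subset sdiff_subset
      have c1 : (insert x B).ncard = B.ncard + 1 := Set.ncard_insert_of_notMem hxB hBf
      have c2 : (A \ {x}).ncard + 1 = A.ncard := Set.ncard_sdiff_singleton_add_one hxA hAf
      have heq : I = (A \ {x} ∪ insert x B) \ {x} := by
        rw [hIe]; ext y; by_cases hy : y = x <;> simp [hy]
      have hex : (x ∈ A \ {x} ∧ x ∉ insert x B) ∨ (x ∉ A \ {x} ∧ x ∈ insert x B) := by simp
      by_cases hc' : (insert x B).ncard < B'.ncard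
      · obtain ⟨y, hy, hyB, hyI⟩ := augN _ hxI hc'
        exact keyN _ _ y hAd hxI hex hy hyB hyI (fun h => hyB (by simp [h])) heq
      · obtain ⟨y, hy, hyA, hyI⟩ := augM _ hAd (by omega)
        exact keyM _ _ y hAd hxI hex hy hyA hyI (fun h => hxA' (h ▸ hy)) heq
    · exact keyN A B x hA hB he hx hxB hxI hxe hIe

theorem twoSumIndep_iff {e : α} {M N : Matroid α} (h : TwoSummable e M N) {I : Set α} :
    TwoSumIndep e M N I ↔ I ⊆ (M.E ∪ N.E) \ {e} ∧ M.Indep (I ∩ M.E) ∧ N.Indep (I ∩ N.E) ∧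
      (M.Indep (insert e (I ∩ M.E)) ∨ N.Indep (insert e (I ∩ N.E))) := by
  have hMN : ∀ x, x ∈ M.E → x ∈ N.E → x = e := fun x hx hx' => by
    have : x ∈ M.E ∩ N.E := ⟨hx, hx'⟩
    rwa [h.inter_eq] at this
  constructor
  · rintro ⟨A, B, hA, hB, he, rfl⟩
    have hAE := hA.subset_ground
    have hBE := hB.subset_ground
    have h1 : (A ∪ B) \ {e} ∩ M.E ⊆ A := by
      rintro x ⟨⟨hx | hx, hxe⟩, hxM⟩
      · exact hx
      · exact absurd (hMN x hxM (hBE hx)) hxe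
    have h2 : (A ∪ B) \ {e} ∩ N.E ⊆ B := by
      rintro x ⟨⟨hx | hx, hxe⟩, hxN⟩
      · exact absurd (hMN x (hAE hx) hxN) hxe
      · exact hx
    refine ⟨sdiff_subset_sdiff_left (union_subset_union hAE hBE), hA.subset h1, hB.subset h2, ?_⟩
    rcases he with he | he
    · exact Or.inl (hA.subset (insert_subset he.1 h1))
    · exact Or.inr (hB.subset (insert_subset he.2 h2))
  · rintro ⟨hI, hA, hB, hAB⟩
    have heI : e ∉ I := fun h => (hI h).2 rfl
    have hIeq : I = (I ∩ M.E) ∪ (I ∩ N.E) := by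
      rw [← inter_union_distrib_left, eq_comm, inter_eq_left]
      exact hI.trans sdiff_subset
    rcases hAB with hAB | hAB
    · refine ⟨_, _, hAB, hB, Or.inl ⟨by simp, fun h => heI h.1⟩, ?_⟩
      rw [insert_union, ← hIeq, insert_sdiff_of_mem _ (mem_singleton e), sdiff_singleton_eq_self heI]
    · refine ⟨_, _, hA, hAB, Or.inr ⟨fun h => heI h.1, by simp⟩, ?_⟩
      rw [union_insert, ← hIeq, insert_sdiff_of_mem _ (mem_singleton e), sdiff_singleton_eq_self heI]

/-- The 2-sum, built from its independent sets. -/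
def TwoSummable.indepMatroid {e : α} {M N : Matroid α} (h : TwoSummable e M N) :
    IndepMatroid α :=
  IndepMatroid.ofFinite (E := (M.E ∪ N.E) \ {e})
    (((h.finite_left.ground_finite).union (h.finite_right.ground_finite)).subset sdiff_subset)
    (TwoSumIndep e M N)
    (by
      refine ⟨{e}, ∅, h.indep_left, N.empty_indep, Or.inl (by simp), by simp⟩)
    (by
      intro I J hJ hIJ
      rw [twoSumIndep_iff h] at hJ ⊢
      have h1 := inter_subset_inter_left M.E hIJ
      have h2 := inter_subset_inter_left N.E hIJ
      exact ⟨hIJ.trans hJ.1, hJ.2.1.subset h1, hJ.2.2.1.subset h2,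
        hJ.2.2.2.imp (fun h => h.subset (insert_subset_insert h1))
          (fun h => h.subset (insert_subset_insert h2))⟩)
    (fun _ _ hI hJ hlt => TwoSumIndep.aug h hI hJ hlt)
    (fun _ hI => ((twoSumIndep_iff h).1 hI).1)

theorem isTwoSumCircuit_subset {e : α} {M N : Matroid α} {C : Set α}
    (hC : IsTwoSumCircuit e M N C) : C ⊆ (M.E ∪ N.E) \ {e} := by
  rcases hC with hC | hC | ⟨C₁, C₂, hC₁, hC₂, -, rfl⟩
  · exact hC.subset_ground.trans (sdiff_subset_sdiff_left subset_union_left)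
  · exact hC.subset_ground.trans (sdiff_subset_sdiff_left subset_union_right)
  · exact sdiff_subset_sdiff_left (union_subset_union hC₁.subset_ground hC₂.subset_ground)

theorem not_twoSumIndep_of_isTwoSumCircuit {e : α} {M N : Matroid α} (h : TwoSummable e M N)
    {C : Set α} (hC : IsTwoSumCircuit e M N C) : ¬ TwoSumIndep e M N C := by
  rw [twoSumIndep_iff h]
  rintro ⟨-, h1, h2, h3⟩
  rcases hC with hC | hC | ⟨C₁, C₂, hC₁, hC₂, he, rfl⟩
  · rw [delete_isCircuit_iff] at hC
    rw [inter_eq_left.2 hC.1.subset_ground] at h1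
    exact hC.1.not_indep h1
  · rw [delete_isCircuit_iff] at hC
    rw [inter_eq_left.2 hC.1.subset_ground] at h2
    exact hC.1.not_indep h2
  · rcases h3 with h3 | h3
    · refine hC₁.not_indep (h3.subset fun x hx => ?_)
      by_cases hxe : x = e
      · exact Or.inl hxe
      · exact Or.inr ⟨⟨Or.inl hx, hxe⟩, hC₁.subset_ground hx⟩
    · refine hC₂.not_indep (h3.subset fun x hx => ?_)
      by_cases hxe : x = e
      · exact Or.inl hxe
      · exact Or.inr ⟨⟨Or.inr hx, hxe⟩, hC₂.subset_ground hx⟩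

theorem exists_isTwoSumCircuit_subset {e : α} {M N : Matroid α} (h : TwoSummable e M N)
    {D : Set α} (hD : D ⊆ (M.E ∪ N.E) \ {e}) (hI : ¬ TwoSumIndep e M N D) :
    ∃ C ⊆ D, IsTwoSumCircuit e M N C := by
  have heMN : e ∈ M.E ∩ N.E := h.inter_eq.symm ▸ mem_singleton e
  have heD : e ∉ D := fun h => (hD h).2 rfl
  by_cases h1 : M.Indep (D ∩ M.E)
  swap
  · obtain ⟨C, hC, hCc⟩ := ((not_indep_iff inter_subset_right).1 h1).exists_isCircuit_subset
    exact ⟨C, hC.trans inter_subset_left, Or.inl (delete_isCircuit_iff.2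
      ⟨hCc, disjoint_singleton_right.2 fun h => heD (hC h).1⟩)⟩
  by_cases h2 : N.Indep (D ∩ N.E)
  swap
  · obtain ⟨C, hC, hCc⟩ := ((not_indep_iff inter_subset_right).1 h2).exists_isCircuit_subset
    exact ⟨C, hC.trans inter_subset_left, Or.inr (Or.inl (delete_isCircuit_iff.2
      ⟨hCc, disjoint_singleton_right.2 fun h => heD (hC h).1⟩))⟩
  rw [twoSumIndep_iff h] at hI
  have h3 : ¬ M.Indep (insert e (D ∩ M.E)) := fun h' => hI ⟨hD, h1, h2, Or.inl h'⟩
  have h4 : ¬ N.Indep (insert e (D ∩ N.E)) := fun h' => hI ⟨hD, h1, h2, Or.inr h'⟩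
  obtain ⟨C₁, hC₁, hC₁c⟩ := ((not_indep_iff
    (insert_subset heMN.1 inter_subset_right)).1 h3).exists_isCircuit_subset
  obtain ⟨C₂, hC₂, hC₂c⟩ := ((not_indep_iff
    (insert_subset heMN.2 inter_subset_right)).1 h4).exists_isCircuit_subset
  have he₁ : e ∈ C₁ := by
    by_contra he
    exact hC₁c.not_indep (h1.subset ((subset_insert_iff_of_notMem he).1 hC₁))
  have he₂ : e ∈ C₂ := by
    by_contra he
    exact hC₂c.not_indep (h2.subset ((subset_insert_iff_of_notMem he).1 hC₂))
  refine ⟨(C₁ ∪ C₂) \ {e}, ?_, Or.inr (Or.inr ⟨C₁, C₂, hC₁c, hC₂c, ⟨he₁, he₂⟩, rfl⟩)⟩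
  rintro x ⟨hx | hx, hxe⟩
  · exact ((hC₁ hx).resolve_left hxe).1
  · exact ((hC₂ hx).resolve_left hxe).1

theorem isTwoSumCircuit_antichain {e : α} {M N : Matroid α} (h : TwoSummable e M N)
    {C C' : Set α} (hC : IsTwoSumCircuit e M N C) (hC' : IsTwoSumCircuit e M N C')
    (hss : C ⊆ C') : C = C' := by
  have hMN : ∀ x, x ∈ M.E → x ∈ N.E → x = e := fun x hx hx' => by
    have : x ∈ M.E ∩ N.E := ⟨hx, hx'⟩
    rwa [h.inter_eq] at this
  have heC : e ∉ C := fun h => (isTwoSumCircuit_subset hC h).2 rfl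
  -- no circuit of either side is contained in `{e}`
  have hM0 : ∀ D, M.IsCircuit D → ¬ D ⊆ {e} := fun D hD hDe =>
    hD.not_indep (h.indep_left.subset hDe)
  have hN0 : ∀ D, N.IsCircuit D → ¬ D ⊆ {e} := fun D hD hDe =>
    hD.not_indep (h.indep_right.subset hDe)
  rcases hC' with hC' | hC' | ⟨D₁, D₂, hD₁, hD₂, hD, rfl⟩
  · rw [delete_isCircuit_iff] at hC'
    have hCM := hss.trans hC'.1.subset_ground
    rcases hC with hC | hC | ⟨C₁, C₂, hC₁, hC₂, he, rfl⟩
    · exact (delete_isCircuit_iff.1 hC).1.eq_of_subset_isCircuit hC'.1 hss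
    · rw [delete_isCircuit_iff] at hC
      exact absurd (fun x hx => hMN x (hCM hx) (hC.1.subset_ground hx)) (hN0 C hC.1)
    · refine absurd (fun x hx => ?_) (hN0 C₂ hC₂)
      by_contra hxe
      exact hxe (hMN x (hCM ⟨Or.inr hx, hxe⟩) (hC₂.subset_ground hx))
  · rw [delete_isCircuit_iff] at hC'
    have hCN := hss.trans hC'.1.subset_ground
    rcases hC with hC | hC | ⟨C₁, C₂, hC₁, hC₂, he, rfl⟩
    · rw [delete_isCircuit_iff] at hC
      exact absurd (fun x hx => hMN x (hC.1.subset_ground hx) (hCN hx)) (hM0 C hC.1)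
    · exact (delete_isCircuit_iff.1 hC).1.eq_of_subset_isCircuit hC'.1 hss
    · refine absurd (fun x hx => ?_) (hM0 C₁ hC₁)
      by_contra hxe
      exact hxe (hMN x (hC₁.subset_ground hx) (hCN ⟨Or.inl hx, hxe⟩))
  · have s1 : ∀ x, x ∈ (D₁ ∪ D₂) \ {e} → x ∈ M.E → x ∈ D₁ := by
      rintro x ⟨hx | hx, hxe⟩ hxM
      · exact hx
      · exact absurd (hMN x hxM (hD₂.subset_ground hx)) hxe
    have s2 : ∀ x, x ∈ (D₁ ∪ D₂) \ {e} → x ∈ N.E → x ∈ D₂ := by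
      rintro x ⟨hx | hx, hxe⟩ hxN
      · exact absurd (hMN x (hD₁.subset_ground hx) hxN) hxe
      · exact hx
    rcases hC with hC | hC | ⟨C₁, C₂, hC₁, hC₂, he, rfl⟩
    · rw [delete_isCircuit_iff] at hC
      have := hC.1.eq_of_subset_isCircuit hD₁ fun x hx => s1 x (hss hx) (hC.1.subset_ground hx)
      exact absurd (this ▸ hD.1) heC
    · rw [delete_isCircuit_iff] at hC
      have := hC.1.eq_of_subset_isCircuit hD₂ fun x hx => s2 x (hss hx) (hC.1.subset_ground hx)
      exact absurd (this ▸ hD.2) heC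
    · have e1 : C₁ = D₁ := hC₁.eq_of_subset_isCircuit hD₁ fun x hx => by
        by_cases hxe : x = e
        · exact hxe ▸ hD.1
        · exact s1 x (hss ⟨Or.inl hx, hxe⟩) (hC₁.subset_ground hx)
      have e2 : C₂ = D₂ := hC₂.eq_of_subset_isCircuit hD₂ fun x hx => by
        by_cases hxe : x = e
        · exact hxe ▸ hD.2
        · exact s2 x (hss ⟨Or.inr hx, hxe⟩) (hC₂.subset_ground hx)
      rw [e1, e2]

theorem TwoSummable.isTwoSum {e : α} {M N : Matroid α} (h : TwoSummable e M N) :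
    IsTwoSum e M N h.indepMatroid.matroid := by
  refine ⟨rfl, fun C => ?_⟩
  have hind : ∀ I, h.indepMatroid.matroid.Indep I ↔ TwoSumIndep e M N I := fun _ => Iff.rfl
  have hdep : ∀ D, IsTwoSumCircuit e M N D → h.indepMatroid.matroid.Dep D := fun D hD =>
    ⟨fun h' => not_twoSumIndep_of_isTwoSumCircuit h hD h', isTwoSumCircuit_subset hD⟩
  rw [isCircuit_iff]
  constructor
  · rintro ⟨⟨hC, hCE⟩, hmin⟩
    obtain ⟨D, hDC, hD⟩ := exists_isTwoSumCircuit_subset h hCE hC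
    exact hmin (hdep D hD) hDC ▸ hD
  · refine fun hC => ⟨hdep C hC, fun D hD hDC => ?_⟩
    obtain ⟨C', hC'D, hC'⟩ := exists_isTwoSumCircuit_subset h hD.2 hD.1
    exact hDC.antisymm (isTwoSumCircuit_antichain h hC' hC (hC'D.trans hDC) ▸ hC'D)

/-- Whenever the 2-sum of `M` and `N` is defined, `twoSum e M N` has the prescribed ground set
and circuits. -/
theorem isTwoSum_twoSum {e : α} {M N : Matroid α} (h : TwoSummable e M N) :
    IsTwoSum e M N (twoSum e M N) := by
  have hex : ∃ R, IsTwoSum e M N R := ⟨_, h.isTwoSum⟩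
  rw [twoSum, dif_pos hex]
  exact hex.choose_spec

end Sums

/-! ## Positroids, Grassmann necklaces and envelope classes -/

section Positroid

variable {α : Type*} [LinearOrder α]

/-- A positroid: a finite matroid on a subset of the totally ordered set `α`, of rank `r` say,
that is realized by a real matrix with `r` rows, and with columns indexed by the ground set,
all of whose maximal minors (the columns being taken in increasing order) are nonnegative. -/
def IsPositroid (M : Matroid α) : Prop :=
  M.Finite ∧ ∃ (r : ℕ) (A : Matrix (Fin r) M.E ℝ), M.eRank = r ∧
    (∀ I : Set M.E, M.Indep (Subtype.val '' I) ↔ LinearIndepOn ℝ A.col I) ∧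
    ∀ c : Fin r ↪o M.E, 0 ≤ (A.submatrix id c).det

/-- `B` is the lexicographically minimal basis of `M` with respect to `<_w`. -/
def IsLexMinBase (M : Matroid α) (w : α) (B : Set α) : Prop :=
  M.IsBase B ∧ ∀ B', M.IsBase B' → B' ≠ B → LexLT w B B'

theorem existsUnique_isLexMinBase (M : Matroid α) (hM : M.Finite) (w : α) :
    ∃! B, M.IsLexMinBase w B := by
  have : Finite {B | M.IsBase B} :=
    (M.ground_finite.finite_subsets.subset fun B (hB : M.IsBase B) => hB.subset_ground).to_subtype
  have : IsTrans {B | M.IsBase B} (fun a b => LexLT w a.1 b.1) := ⟨fun _ _ _ => LexLT.trans⟩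
  have : Std.Irrefl (fun a b : {B | M.IsBase B} => LexLT w a.1 b.1) :=
    ⟨fun a => not_lexLT_self w a.1⟩
  obtain ⟨B₀, hB₀⟩ := M.exists_isBase
  obtain ⟨⟨B, hB⟩, -, hmin⟩ :=
    (Finite.wellFounded_of_trans_of_irrefl
      (fun a b : {B | M.IsBase B} => LexLT w a.1 b.1)).has_min univ ⟨⟨B₀, hB₀⟩, mem_univ _⟩
  have hfin : ∀ B, M.IsBase B → B.Finite := fun B hB => M.ground_finite.subset hB.subset_ground
  refine ⟨B, ⟨hB, fun B' hB' hne => ?_⟩, ?_⟩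
  · exact (lexLT_total (hfin _ hB') (hfin _ hB) hne).resolve_left
      (hmin ⟨B', hB'⟩ (mem_univ _))
  · rintro B' ⟨hB', hmin'⟩
    by_contra hne
    exact hmin ⟨B', hB'⟩ (mem_univ _) (hmin' B hB (Ne.symm hne))

/-- The member `J_w` of the Grassmann necklace of the finite matroid `M`: the lexicographically
minimal basis with respect to `<_w`, written as the union of the one-element family of all such
bases. -/
def necklace (M : Matroid α) (w : α) : Set α := ⋃₀ {B | M.IsLexMinBase w B}

theorem isLexMinBase_iff_eq_necklace (M : Matroid α) (hM : M.Finite) (w : α) (B : Set α) :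
    M.IsLexMinBase w B ↔ B = M.necklace w := by
  obtain ⟨B₀, hB₀, huniq⟩ := existsUnique_isLexMinBase M hM w
  have : {B | M.IsLexMinBase w B} = {B₀} := by
    ext B'
    exact ⟨fun h => huniq B' h, fun h => h ▸ hB₀⟩
  rw [necklace, this, sUnion_singleton]
  exact ⟨fun h => huniq B h, fun h => h ▸ hB₀⟩

/-- `P` is the positroid envelope of the ordered matroid `M`: `P` is a positroid on the ground
set of `M`, and it has the same Grassmann necklace `(J_w)`, `w` running over the ground set. -/
def IsPositroidEnvelope (P M : Matroid α) : Prop :=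
  P.IsPositroid ∧ P.E = M.E ∧ ∀ w ∈ M.E, P.necklace w = M.necklace w

/-- The positroid envelope class `Ω_P`. -/
def envelopeClass (P : Matroid α) : Set (Matroid α) :=
  {M | M.Finite ∧ IsPositroidEnvelope P M}

end Positroid

end Matroid

/-! The Grassmann necklace of a matroid carries the same information as the ranks of its cyclic
intervals (arcs). The basis `J_w` is greedy, so it meets every initial segment of `<_w` in a basis
of that segment. Conversely, `x` lies in `J_w` exactly when `x` raises the rank of the elements
before it (`necklace_eq_iff`). For a positroid `P`, the class `Ω_P` therefore consists of the finite
matroids on `E(P)` with the ranks of `P` on all arcs (`mem_envelopeClass_iff`), and lexicographic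
orders disappear from the argument.

Non-crossing links the arcs of `(E(P) ∪ E(Q)) \ {e}` with those of `E(P)` and `E(Q)`. Contracting
the other side to `e` takes arcs to arcs (`IsArc.pullback`), and so does expanding `e` to the other
side (`IsArc.expand`). The rank formula `r(A ∪ B) = min (r_M(A) + r_N(B)) (r_M(A + e) + r_N(B + e) -
1)` (`TwoSummable.rk_union`) then shows that arc ranks of the summands determine arc ranks of the
2-sum (`TwoSummable.rk_arc_eq`).

For the converse, let `R` have the arc ranks of `P ⊕₂ Q`. The two sides are arcs, so they have
connectivity one in `R`, and `R` splits as a 2-sum `M ⊕₂ N` (`exists_split`,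
`TwoSummable.exists_eq_twoSum`). The ranks of `M` and `N` on arcs are expressed by ranks of expanded
arcs in `R`, hence agree with those of `P` and `Q` (`TwoSummable.rk_split_eq`).

Finally `P ⊕₂ Q` must be a positroid, since otherwise its class would be empty
(`TwoSummable.isPositroid`). Seen from `e`, one side precedes the other. After cyclic shifts and row
operations the column of `e` is a unit vector in both realizations, and overlapping the two matrices
in that row gives a matrix whose maximal minors vanish or factor into minors of the two. -/

/-! ## Rank in finite matroids -/

namespace Matroid

section Rank

variable {α : Type*} {M : Matroid α}

/-- The rank of a set in a finite matroid, as a natural number. -/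
noncomputable def rk (M : Matroid α) (X : Set α) : ℕ := (M.eRk X).toNat

theorem coe_rk (M : Matroid α) [M.Finite] (X : Set α) : (M.rk X : ℕ∞) = M.eRk X :=
  ENat.natCast_toNat (eRk_ne_top_iff.2 (M.isRkFinite_set X))

theorem rk_mono (M : Matroid α) [M.Finite] {X Y : Set α} (h : X ⊆ Y) : M.rk X ≤ M.rk Y := by
  have := M.eRk_mono h
  rw [← coe_rk, ← coe_rk] at this
  exact_mod_cast this

theorem rk_inter_add_rk_union_le (M : Matroid α) [M.Finite] (X Y : Set α) :
    M.rk (X ∩ Y) + M.rk (X ∪ Y) ≤ M.rk X + M.rk Y := by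
  have := M.eRk_inter_add_eRk_union_le X Y
  simp only [← coe_rk] at this
  exact_mod_cast this

@[simp] theorem rk_empty (M : Matroid α) : M.rk ∅ = 0 := by simp [rk]

theorem rk_insert_le (M : Matroid α) [M.Finite] (e : α) (X : Set α) :
    M.rk (insert e X) ≤ M.rk X + 1 := by
  have := M.eRk_insert_le_add_one e X
  simp only [← coe_rk] at this
  exact_mod_cast this

theorem Indep.finite_of_finite [M.Finite] {I : Set α} (h : M.Indep I) : I.Finite :=
  M.ground_finite.subset h.subset_ground

theorem Indep.rk_eq_ncard {I : Set α} (h : M.Indep I) : M.rk I = I.ncard := by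
  rw [rk, h.eRk_eq_encard, ncard_def]

theorem Indep.ncard_le_rk [M.Finite] {I X : Set α} (h : M.Indep I) (hX : I ⊆ X) :
    I.ncard ≤ M.rk X := h.rk_eq_ncard ▸ M.rk_mono hX

theorem indep_of_ncard_le_rk [M.Finite] {I : Set α} (hI : I.Finite) (h : I.ncard ≤ M.rk I) :
    M.Indep I := by
  refine (M.isRkFinite_set I).indep_of_encard_le_eRk ?_
  rw [← coe_rk, ← hI.cast_ncard_eq]
  exact_mod_cast h

theorem IsBasis.rk_eq_ncard {I X : Set α} (h : M.IsBasis I X) : M.rk X = I.ncard := by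
  rw [rk, h.eRk_eq_encard, ncard_def]

theorem rk_ground (M : Matroid α) : M.rk M.E = M.eRank.toNat := by rw [rk, eRk_ground]

theorem IsBase.ncard_eq_rk {B : Set α} (h : M.IsBase B) : B.ncard = M.rk M.E := by
  rw [rk_ground, ncard_def, h.encard_eq_eRank]

theorem Indep.isBase_of_rk_le [M.Finite] {I : Set α} (h : M.Indep I) (hI : M.rk M.E ≤ I.ncard) :
    M.IsBase I := by
  refine h.isBase_of_eRk_ge h.finite_of_finite ?_
  rw [← eRk_ground, ← coe_rk, ← coe_rk, h.rk_eq_ncard]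
  exact_mod_cast hI

theorem exists_rk_insert_of_lt [M.Finite] {X Y : Set α} (h : M.rk X < M.rk Y) :
    ∃ y ∈ Y, y ∉ X ∧ M.rk (insert y X) = M.rk X + 1 := by
  obtain ⟨y, hy, h'⟩ := M.exists_eRk_insert_eq_add_one_of_lt (X := X) (Y := Y) (by
    rw [← coe_rk, ← coe_rk]; exact_mod_cast h)
  refine ⟨y, hy.1, hy.2, ?_⟩
  simp only [← coe_rk] at h'
  exact_mod_cast h'

theorem ext_rk {M N : Matroid α} [M.Finite] [N.Finite] (hE : M.E = N.E)
    (h : ∀ X ⊆ M.E, M.rk X = N.rk X) : M = N := by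
  refine ext_indep hE fun I hI => ?_
  have hf := M.ground_finite.subset hI
  exact ⟨fun h' => indep_of_ncard_le_rk hf (by rw [← h I hI, h'.rk_eq_ncard]),
    fun h' => indep_of_ncard_le_rk hf (by rw [h I hI, h'.rk_eq_ncard])⟩

end Rank

end Matroid

/-! ## Arcs -/

section Arc

variable {α : Type*} [LinearOrder α]

/-- `I` is a cyclic interval of `E`. -/
def IsArc (E I : Set α) : Prop := I ⊆ E ∧ NonCrossing I (E \ I)

/-- `I` is an initial segment of `E` in the cyclic shift that starts at `w`. -/
def IsInitialSegment (E : Set α) (w : α) (I : Set α) : Prop :=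
  I ⊆ E ∧ ∀ y ∈ I, ∀ z ∈ E, ShiftLT w z y → z ∈ I

theorem isArc_self (E : Set α) : IsArc E E :=
  ⟨Subset.rfl, by rintro ⟨w, -, x, hx, -⟩; exact hx.2 hx.1⟩

theorem NonCrossing.mono {X Y X' Y' : Set α} (h : NonCrossing X Y) (hX : X' ⊆ X) (hY : Y' ⊆ Y) :
    NonCrossing X' Y' := by
  rintro ⟨w, hw, x, hx, y, hy, z, hz, h'⟩
  exact h ⟨w, hX hw, x, hY hx, y, hX hy, z, hY hz, h'⟩

/-- An alternating quadruple may be read cyclically from its second entry on. -/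
theorem NonCrossing.symm {X Y : Set α} (h : NonCrossing X Y) : NonCrossing Y X := by
  rintro ⟨w, hw, x, hx, y, hy, z, hz, h1, h2, h3⟩
  refine h ⟨x, hx, y, hy, z, hz, w, hw, ?_⟩
  unfold ShiftLT at *
  grind

/-- No outside point precedes an inside point in `<_w`, which rules out a cyclically alternating
quadruple. -/
theorem IsInitialSegment.isArc {E I : Set α} {w : α} (h : IsInitialSegment E w I) :
    IsArc E I := by
  refine ⟨h.1, ?_⟩
  rintro ⟨a, ha, b, hb, c, hc, d, hd, h1, h2, h3⟩
  have k1 : ¬ ShiftLT w b a := fun h' => hb.2 (h.2 a ha b hb.1 h')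
  have k2 : ¬ ShiftLT w b c := fun h' => hb.2 (h.2 c hc b hb.1 h')
  have k3 : ¬ ShiftLT w d a := fun h' => hd.2 (h.2 a ha d hd.1 h')
  have k4 : ¬ ShiftLT w d c := fun h' => hd.2 (h.2 c hc d hd.1 h')
  unfold ShiftLT at *
  grind

theorem exists_shiftLT_min (w : α) {I : Set α} (hI : I.Finite) (hne : I.Nonempty) :
    ∃ x ∈ I, ∀ y ∈ I, ¬ ShiftLT w y x := by
  have : Finite I := hI.to_subtype
  have : IsTrans I (fun a b => ShiftLT w a.1 b.1) := ⟨fun _ _ _ => ShiftLT.trans⟩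
  have : Std.Irrefl (fun a b : I => ShiftLT w a.1 b.1) := ⟨fun a => not_shiftLT_self w a.1⟩
  obtain ⟨x, -, hx⟩ := (Finite.wellFounded_of_trans_of_irrefl
    (fun a b : I => ShiftLT w a.1 b.1)).has_min univ ⟨⟨_, hne.some_mem⟩, mem_univ _⟩
  exact ⟨x.1, x.2, fun y hy h => hx ⟨y, hy⟩ (mem_univ _) h⟩

theorem IsArc.exists_isInitialSegment {E I : Set α} (h : IsArc E I) (hI : I.Finite)
    (hne : I.Nonempty) : ∃ w ∈ E, IsInitialSegment E w I := by
  by_cases hE : E ⊆ I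
  · exact ⟨_, h.1 hne.some_mem, h.1, fun _ _ z hz _ => hE hz⟩
  · obtain ⟨d, hdE, hdI⟩ := not_subset.1 hE
    obtain ⟨w, hw, hmin⟩ := exists_shiftLT_min d hI hne
    refine ⟨w, h.1 hw, h.1, fun y hy z hz hzy => ?_⟩
    by_contra hzI
    refine h.2 ⟨w, hw, z, ⟨hz, hzI⟩, y, hy, d, ⟨hdE, hdI⟩, ?_⟩
    have h1 := hmin y hy
    have h2 : z ≠ w := fun h => hzI (h ▸ hw)
    have h3 : d ≠ w := fun h => hdI (h ▸ hw)
    have h4 : d ≠ y := fun h => hdI (h ▸ hy)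
    clear hmin h hE
    unfold ShiftLT at *
    grind

/-- Replacing `e` by an element `q` of a set not crossing `E` preserves arcs. -/
theorem IsArc.pullback {E F I : Set α} {e q : α} (hEF : NonCrossing E F) (he : E ∩ F = {e})
    (hq : q ∈ F) (hqe : q ≠ e) (h : IsArc ((E ∪ F) \ {e}) I) :
    IsArc E {x | x ∈ E ∧ (x ≠ e ∧ x ∈ I ∨ x = e ∧ q ∈ I)} := by
  have heE : e ∈ E := (he.symm ▸ mem_singleton e : e ∈ E ∩ F).1
  have heF : e ∈ F := (he.symm ▸ mem_singleton e : e ∈ E ∩ F).2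
  have hqE : q ∉ E := fun h => hqe (by rw [← mem_singleton_iff, ← he]; exact ⟨h, hq⟩)
  refine ⟨fun x hx => hx.1, ?_⟩
  -- `q` and `e` lie in the same gap of `E \ {e}`
  have key : ∀ a ∈ E, ∀ b ∈ E, a ≠ e → b ≠ e → (ShiftLT a e b ↔ ShiftLT a q b) := by
    intro a ha b hb hae hbe
    have h1 : a ≠ q := fun h => hqE (h ▸ ha)
    have h2 : b ≠ q := fun h => hqE (h ▸ hb)
    have c1 : ¬ (ShiftLT a a e ∧ ShiftLT a e b ∧ ShiftLT a b q) := fun h =>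
      hEF ⟨a, ha, e, heF, b, hb, q, hq, h⟩
    have c2 : ¬ (ShiftLT a a q ∧ ShiftLT a q b ∧ ShiftLT a b e) := fun h =>
      hEF ⟨a, ha, q, hq, b, hb, e, heF, h⟩
    unfold ShiftLT at *
    grind
  rintro ⟨a, ⟨haE, ha⟩, b, ⟨hbE, hb⟩, c, ⟨hcE, hc⟩, d, ⟨hdE, hd⟩, h1, h2, h3⟩
  replace hb : ¬ (b ≠ e ∧ b ∈ I ∨ b = e ∧ q ∈ I) := fun h => hb ⟨hbE, h⟩
  replace hd : ¬ (d ≠ e ∧ d ∈ I ∨ d = e ∧ q ∈ I) := fun h => hd ⟨hdE, h⟩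
  have hS : ∀ x ∈ E, x ≠ e → x ∈ (E ∪ F) \ {e} := fun x hx hxe => ⟨Or.inl hx, hxe⟩
  have hqS : q ∈ (E ∪ F) \ {e} := ⟨Or.inr hq, hqe⟩
  have hne : ∀ x ∈ E, x ≠ q := fun x hx h => hqE (h ▸ hx)
  have hx : ∀ a ∈ I, ∀ b ∈ (E ∪ F) \ {e}, b ∉ I → ∀ c ∈ I, ∀ d ∈ (E ∪ F) \ {e}, d ∉ I →
      ¬ (ShiftLT a a b ∧ ShiftLT a b c ∧ ShiftLT a c d) := fun a ha b hb hb' c hc d hd hd' h' =>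
    h.2 ⟨a, ha, b, ⟨hb, hb'⟩, c, hc, d, ⟨hd, hd'⟩, h'⟩
  -- At most one entry of an alternating quadruple is `e`. Replacing it by `q`, which lies in the
  -- same gap, gives an alternating quadruple for `I`.
  by_cases hae : a = e
  · subst hae
    have hba : b ≠ a := by unfold ShiftLT at *; grind
    have hca : c ≠ a := by unfold ShiftLT at *; grind
    have hda : d ≠ a := by unfold ShiftLT at *; grind
    refine hx q (by tauto) b (hS b hbE hba) (by tauto) c (by tauto) d (hS d hdE hda) (by tauto) ?_
    have k1 := key b hbE c hcE hba hca
    have k2 := key b hbE d hdE hba hda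
    have k3 := key c hcE d hdE hca hda
    have k4 := hne b hbE
    have k5 := hne c hcE
    have k6 := hne d hdE
    clear key hx hne hS
    unfold ShiftLT at *
    grind
  by_cases hbe : b = e
  · subst hbe
    have hca : c ≠ b := by unfold ShiftLT at *; grind
    have hda : d ≠ b := by unfold ShiftLT at *; grind
    refine hx a (by tauto) q hqS (by tauto) c (by tauto) d (hS d hdE hda) (by tauto) ?_
    have k1 := key a haE c hcE hae hca
    have k2 := key a haE d hdE hae hda
    have k3 := key c hcE d hdE hca hda
    have k4 := hne a haE
    have k5 := hne c hcE
    have k6 := hne d hdE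
    clear key hx hne hS
    unfold ShiftLT at *
    grind
  by_cases hce : c = e
  · subst hce
    have hda : d ≠ c := by unfold ShiftLT at *; grind
    refine hx a (by tauto) b (hS b hbE hbe) (by tauto) q (by tauto) d (hS d hdE hda) (by tauto) ?_
    have k1 := key a haE b hbE hae hbe
    have k2 := key a haE d hdE hae hda
    have k3 := key b hbE d hdE hbe hda
    have k4 := hne a haE
    have k5 := hne b hbE
    have k6 := hne d hdE
    clear key hx hne hS
    unfold ShiftLT at *
    grind
  by_cases hde : d = e
  · subst hde
    refine hx a (by tauto) b (hS b hbE hbe) (by tauto) c (by tauto) q hqS (by tauto) ?_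
    have k1 := key a haE b hbE hae hbe
    have k2 := key a haE c hcE hae hce
    have k3 := key b hbE c hcE hbe hce
    have k4 := hne a haE
    have k5 := hne b hbE
    have k6 := hne c hcE
    clear key hx hne hS
    unfold ShiftLT at *
    grind
  exact hx a (by tauto) b (hS b hbE hbe) (by tauto) c (by tauto) d (hS d hdE hde) (by tauto)
    ⟨h1, h2, h3⟩

/-- Expanding `e` to a set not crossing `E` preserves arcs. -/
theorem IsArc.expand {E F I : Set α} {e : α} (hEF : NonCrossing E F) (he : E ∩ F = {e})
    (h : IsArc E I) :
    IsArc ((E ∪ F) \ {e}) {x | x ≠ e ∧ (x ∈ E ∧ x ∈ I ∨ x ∈ F ∧ e ∈ I)} := by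
  have heE : e ∈ E := (he.symm ▸ mem_singleton e : e ∈ E ∩ F).1
  have heF : e ∈ F := (he.symm ▸ mem_singleton e : e ∈ E ∩ F).2
  have hd : ∀ x ∈ E, x ∈ F → x = e := fun x hx hx' => by
    rw [← mem_singleton_iff, ← he]; exact ⟨hx, hx'⟩
  refine ⟨fun x hx => ⟨by have := hx.2; tauto, hx.1⟩, ?_⟩
  rintro ⟨a, ⟨hae, ha⟩, b, ⟨⟨hbS, hbe⟩, hb⟩, c, ⟨hce, hc⟩, d, ⟨⟨hdS, hde⟩, hd'⟩, h1, h2, h3⟩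
  simp only [mem_singleton_iff] at hbe hde
  replace hb : ¬ (b ∈ E ∧ b ∈ I ∨ b ∈ F ∧ e ∈ I) := fun h => hb ⟨hbe, h⟩
  replace hd' : ¬ (d ∈ E ∧ d ∈ I ∨ d ∈ F ∧ e ∈ I) := fun h => hd' ⟨hde, h⟩
  have hx : ∀ a ∈ I, ∀ b ∈ E, b ∉ I → ∀ c ∈ I, ∀ d ∈ E, d ∉ I →
      ¬ (ShiftLT a a b ∧ ShiftLT a b c ∧ ShiftLT a c d) := fun a ha b hb hb' c hc d hd hd' h' =>
    h.2 ⟨a, ha, b, ⟨hb, hb'⟩, c, hc, d, ⟨hd, hd'⟩, h'⟩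
  have hcr : ∀ a ∈ E, ∀ b ∈ F, ∀ c ∈ E, ∀ d ∈ F,
      ¬ (ShiftLT a a b ∧ ShiftLT a b c ∧ ShiftLT a c d) := fun a ha b hb c hc d hd h' =>
    hEF ⟨a, ha, b, hb, c, hc, d, hd, h'⟩
  -- If `e ∈ I`, the outside points `b, d` lie in `E`. When both `a, c` lie in `F`, the sets `E` and
  -- `F` cross. When only one does, either it can be replaced by `e`, contradicting that `I` is an
  -- arc, or `E` and `F` cross. If `e ∉ I`, the roles of inside and outside points are exchanged.
  by_cases heI : e ∈ I
  · have hbE : b ∈ E := by simp only [mem_union] at hbS; tauto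
    have hdE : d ∈ E := by simp only [mem_union] at hdS; tauto
    have hbI : b ∉ I := by tauto
    have hdI : d ∉ I := by tauto
    by_cases haF : a ∈ F
    · have k1 := hx e heI b hbE hbI
      by_cases hcF : c ∈ F
      · have := hcr b hbE c hcF d hdE a haF
        unfold ShiftLT at *
        grind
      · have k2 := hx e heI b hbE hbI c (by tauto) d hdE hdI
        have k3 := hcr b hbE e heF d hdE a haF
        have k4 := hcr d hdE a haF b hbE e heF
        clear hx hcr k1
        unfold ShiftLT at *
        grind
    · by_cases hcF : c ∈ F
      · have k2 := hx a (by tauto) b hbE hbI e heI d hdE hdI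
        have k3 := hcr b hbE e heF d hdE c hcF
        have k4 := hcr b hbE c hcF d hdE e heF
        clear hx hcr
        unfold ShiftLT at *
        grind
      · exact hx a (by tauto) b hbE hbI c (by tauto) d hdE hdI ⟨h1, h2, h3⟩
  · have haE : a ∈ E := by tauto
    have hcE : c ∈ E := by tauto
    have haI : a ∈ I := by tauto
    have hcI : c ∈ I := by tauto
    by_cases hbF : b ∈ F
    · by_cases hdF : d ∈ F
      · exact hcr a haE b hbF c hcE d hdF ⟨h1, h2, h3⟩
      · have hdE : d ∈ E := hdS.resolve_right hdF
        have k2 := hx a haI e heE heI c hcI d hdE (by tauto)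
        have k3 := hcr a haE b hbF c hcE e heF
        clear hx hcr
        unfold ShiftLT at *
        grind
    · have hbE : b ∈ E := hbS.resolve_right hbF
      by_cases hdF : d ∈ F
      · have k2 := hx a haI b hbE (by tauto) c hcI e heE heI
        have k3 := hcr a haE e heF c hcE d hdF
        clear hx hcr
        unfold ShiftLT at *
        grind
      · have hdE : d ∈ E := hdS.resolve_right hdF
        exact hx a haI b hbE (fun h => hb (Or.inl ⟨hbE, h⟩)) c hcI d hdE
          (fun h => hd' (Or.inl ⟨hdE, h⟩)) ⟨h1, h2, h3⟩

end Arc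

/-! ## The Grassmann necklace and the ranks of arcs -/

namespace Matroid

section Necklace

variable {α : Type*} [LinearOrder α] {M P : Matroid α}

/-- Greedy argument: if some `z ∈ I` could be added to `B ∩ I`, a basis `B'` containing both would
first differ from `B` in an element `x` of `B` outside `I`. But `z` precedes every such `x` and
already distinguishes `B'` from `B`. -/
theorem IsLexMinBase.isBasis_inter {w : α} {B I : Set α} (h : M.IsLexMinBase w B)
    (hI : IsInitialSegment M.E w I) : M.IsBasis (B ∩ I) I := by
  have hBI : M.Indep (B ∩ I) := h.1.indep.subset inter_subset_left
  refine hBI.isBasis_of_subset_of_subset_closure inter_subset_right fun z hz => ?_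
  by_contra hzc
  have hzi : M.Indep (insert z (B ∩ I)) :=
    hBI.insert_indep_iff.2 (Or.inl ⟨hI.1 hz, hzc⟩)
  have hzB : z ∉ B := fun hzB => hzc (M.subset_closure _ hBI.subset_ground ⟨hzB, hz⟩)
  obtain ⟨B', hB', hsub, -⟩ := hzi.exists_isBase_subset_union_isBase h.1
  have hzB' : z ∈ B' := hsub (mem_insert _ _)
  obtain ⟨x, hxB, hxB', hx⟩ := h.2 B' hB' fun h => hzB (h ▸ hzB')
  have hxI : x ∉ I := fun hxI => hxB' (hsub (mem_insert_of_mem _ ⟨hxB, hxI⟩))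
  rcases shiftLT_trichotomy w z x with hzx | rfl | hzx
  · exact hzB ((hx z hzx).2 hzB')
  · exact hxI hz
  · exact hxI (hI.2 z hz x (h.1.subset_ground hxB) hzx)

theorem isInitialSegment_setOf (E : Set α) (w x : α) :
    IsInitialSegment E w {y ∈ E | ShiftLT w y x} :=
  ⟨fun _ hy => hy.1, fun _ hy _ hz hzy => ⟨hz, hzy.trans hy.2⟩⟩

theorem isInitialSegment_insert_setOf {E : Set α} {w x : α} (hx : x ∈ E) :
    IsInitialSegment E w (insert x {y ∈ E | ShiftLT w y x}) := by
  refine ⟨insert_subset hx fun _ hy => hy.1, ?_⟩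
  rintro y (rfl | hy) z hz hzy
  · exact Or.inr ⟨hz, hzy⟩
  · exact Or.inr ⟨hz, hzy.trans hy.2⟩

/-- The predecessors of `x`, with and without `x`, form initial segments, so their ranks count the
necklace elements in them. -/
theorem mem_necklace_iff (hM : M.Finite) {w x : α} :
    x ∈ M.necklace w ↔ x ∈ M.E ∧
      M.rk (insert x {y ∈ M.E | ShiftLT w y x}) ≠ M.rk {y ∈ M.E | ShiftLT w y x} := by
  have hB : M.IsLexMinBase w (M.necklace w) := (isLexMinBase_iff_eq_necklace M hM w _).2 rfl
  by_cases hxE : x ∈ M.E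
  swap
  · exact ⟨fun h => absurd (hB.1.subset_ground h) hxE, fun h => absurd h.1 hxE⟩
  have h1 := (hB.isBasis_inter (isInitialSegment_setOf M.E w x)).rk_eq_ncard
  have h2 := (hB.isBasis_inter (isInitialSegment_insert_setOf (w := w) hxE)).rk_eq_ncard
  rw [h1, h2]
  by_cases hxB : x ∈ M.necklace w
  · rw [inter_insert_of_mem hxB, ncard_insert_of_notMem
      (fun h => not_shiftLT_self w x h.2.2) (hB.1.indep.subset inter_subset_left).finite_of_finite]
    simp [hxB, hxE]
  · rw [inter_insert_of_notMem hxB]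
    simp [hxB]

/-- Two matroids have the same Grassmann necklace if and only if their rank functions agree on all
cyclic intervals. -/
theorem necklace_eq_iff (hP : P.Finite) (hM : M.Finite) (hE : P.E = M.E) :
    (∀ w ∈ M.E, P.necklace w = M.necklace w) ↔ ∀ I, IsArc P.E I → P.rk I = M.rk I := by
  constructor
  · intro h I hI
    obtain rfl | hne := I.eq_empty_or_nonempty
    · simp
    -- The starting point must lie in the ground set, as necklaces are compared only there.
    obtain ⟨w, hw, hwI⟩ := hI.exists_isInitialSegment (P.ground_finite.subset hI.1) hne
    have h1 := (((isLexMinBase_iff_eq_necklace P hP w _).2 rfl).isBasis_inter hwI).rk_eq_ncard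
    have h2 := (((isLexMinBase_iff_eq_necklace M hM w _).2 rfl).isBasis_inter
      (hE ▸ hwI)).rk_eq_ncard
    rw [h1, h2, h w (hE ▸ hw)]
  · intro h w _
    rw [hE] at h
    ext x
    rw [mem_necklace_iff hP, mem_necklace_iff hM, hE]
    refine and_congr_right fun hx => ?_
    rw [h _ (isInitialSegment_setOf M.E w x).isArc,
      h _ (isInitialSegment_insert_setOf (w := w) hx).isArc]

theorem mem_envelopeClass_iff (hP : P.IsPositroid) :
    M ∈ P.envelopeClass ↔ M.Finite ∧ P.E = M.E ∧ ∀ I, IsArc P.E I → P.rk I = M.rk I := by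
  constructor
  · rintro ⟨hM, -, hE, h⟩
    exact ⟨hM, hE, (necklace_eq_iff hP.1 hM hE).1 h⟩
  · rintro ⟨hM, hE, h⟩
    exact ⟨hM, hP, hE, (necklace_eq_iff hP.1 hM hE).2 h⟩

theorem isArc_singleton {E : Set α} {e : α} (he : e ∈ E) : IsArc E {e} := by
  refine ⟨singleton_subset_iff.2 he, ?_⟩
  rintro ⟨w, rfl, x, -, y, rfl, z, -, h1, h2, -⟩
  unfold ShiftLT at *
  grind

theorem isArc_sdiff_singleton {E : Set α} {e : α} : IsArc E (E \ {e}) := by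
  refine ⟨sdiff_subset, ?_⟩
  rintro ⟨w, -, x, hx, y, -, z, hz, -, h1, h2⟩
  obtain rfl : x = e := by by_contra h; exact hx.2 ⟨hx.1, h⟩
  obtain rfl : z = x := by by_contra h; exact hz.2 ⟨hz.1, h⟩
  unfold ShiftLT at *
  grind

end Necklace

/-! ## Ranks in a 2-sum -/

section TwoSum

variable {α : Type*} {M N : Matroid α} {e : α}

theorem connectivity_eq (M : Matroid α) (X : Set α) :
    M.connectivity X = (M.rk X : ℤ) + M.rk (M.E \ X) - M.rk M.E := by
  rw [connectivity, rk_ground, rk, rk]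

theorem TwoSummable.symm (h : TwoSummable e M N) : TwoSummable e N M :=
  ⟨h.finite_right, h.finite_left, h.two_le_right, h.two_le_left,
    by rw [inter_comm]; exact h.inter_eq, h.not_sep_right, h.not_sep_left⟩

theorem TwoSummable.mem_left (h : TwoSummable e M N) : e ∈ M.E :=
  h.indep_left.subset_ground (mem_singleton e)

theorem TwoSummable.mem_right (h : TwoSummable e M N) : e ∈ N.E := h.symm.mem_left

theorem TwoSummable.rk_singleton (h : TwoSummable e M N) : M.rk {e} = 1 := by
  rw [h.indep_left.rk_eq_ncard, ncard_singleton]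

/-- A drop in rank would make the connectivity of `{e}` at most `1 + (r - 1) - r = 0`, hence `{e}` a
1-separation. -/
theorem TwoSummable.rk_sdiff (h : TwoSummable e M N) : M.rk (M.E \ {e}) = M.rk M.E := by
  have := h.finite_left
  have h1 := h.not_sep_left
  have h2 := h.rk_singleton
  have h3 := ncard_sdiff_singleton_add_one h.mem_left M.ground_finite
  have h4 := h.two_le_left
  have h5 := M.rk_mono (sdiff_subset : M.E \ {e} ⊆ M.E)
  by_contra hne
  refine h1 ⟨singleton_subset_iff.2 h.mem_left, by simp, by omega, ?_⟩
  rw [connectivity_eq]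
  push_cast
  omega

theorem TwoSummable.twoSum_eq (h : TwoSummable e M N) : twoSum e M N = h.indepMatroid.matroid :=
  (isTwoSum_twoSum h).eq h.isTwoSum

theorem TwoSummable.twoSum_comm (h : TwoSummable e M N) : twoSum e M N = twoSum e N M := by
  obtain ⟨hE, hC⟩ := isTwoSum_twoSum h.symm
  refine (isTwoSum_twoSum h).eq ⟨hE.trans (by rw [union_comm]), fun C => (hC C).trans ?_⟩
  constructor
  · rintro (h | h | ⟨C₁, C₂, h₁, h₂, he, rfl⟩)
    · exact Or.inr (Or.inl h)
    · exact Or.inl h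
    · exact Or.inr (Or.inr ⟨C₂, C₁, h₂, h₁, he.symm, by rw [union_comm]⟩)
  · rintro (h | h | ⟨C₁, C₂, h₁, h₂, he, rfl⟩)
    · exact Or.inr (Or.inl h)
    · exact Or.inl h
    · exact Or.inr (Or.inr ⟨C₂, C₁, h₂, h₁, he.symm, by rw [union_comm]⟩)

theorem TwoSummable.ground_eq (h : TwoSummable e M N) :
    (twoSum e M N).E = (M.E ∪ N.E) \ {e} := (isTwoSum_twoSum h).1

theorem TwoSummable.indep_iff (h : TwoSummable e M N) {I : Set α} :
    (twoSum e M N).Indep I ↔ TwoSumIndep e M N I := by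
  rw [h.twoSum_eq]; rfl

theorem TwoSummable.finite (h : TwoSummable e M N) : (twoSum e M N).Finite := by
  refine ⟨?_⟩
  rw [h.ground_eq]
  exact (h.finite_left.ground_finite.union h.finite_right.ground_finite).subset sdiff_subset

/-- The rank of `A ∪ B` in the 2-sum, plus one. -/
theorem TwoSummable.rk_union (h : TwoSummable e M N) {A B : Set α} (hA : A ⊆ M.E \ {e})
    (hB : B ⊆ N.E \ {e}) :
    (twoSum e M N).rk (A ∪ B) + 1 =
      min (M.rk A + N.rk B + 1) (M.rk (insert e A) + N.rk (insert e B)) := by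
  have := h.finite_left
  have := h.finite_right
  have := h.finite
  have hMN : ∀ x, x ∈ M.E → x ∈ N.E → x = e := fun x hx hx' => by
    rw [← mem_singleton_iff, ← h.inter_eq]; exact ⟨hx, hx'⟩
  have hAM : A ⊆ M.E := hA.trans sdiff_subset
  have hBN : B ⊆ N.E := hB.trans sdiff_subset
  have heA : e ∉ A := fun h => (hA h).2 rfl
  have heB : e ∉ B := fun h => (hB h).2 rfl
  have low : ∀ X Y, M.Indep X → N.Indep Y → X ⊆ insert e A → Y ⊆ insert e B →
      ((e ∈ X ∧ e ∉ Y) ∨ (e ∉ X ∧ e ∈ Y)) →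
      X.ncard + Y.ncard ≤ (twoSum e M N).rk (A ∪ B) + 1 := by
    intro X Y hX hY hXA hYB he
    rw [← TwoSumIndep.ncard h hX hY he]
    refine Nat.add_le_add_right (Indep.ncard_le_rk (h.indep_iff.2 ⟨X, Y, hX, hY, he, rfl⟩) ?_) 1
    rintro x ⟨hx | hx, hxe⟩
    · exact Or.inl ((hXA hx).resolve_left hxe)
    · exact Or.inr ((hYB hx).resolve_left hxe)
  apply le_antisymm
  -- Upper bound: a basis of `A ∪ B` comes from independent sets `X`, `Y` exactly one of which
  -- contains `e`. Counting with and without `e` bounds its size by both terms.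
  · obtain ⟨I, hI⟩ := (twoSum e M N).exists_isBasis (A ∪ B) (by
      rw [h.ground_eq, union_sdiff_distrib]; exact union_subset_union hA hB)
    obtain ⟨X, Y, hX, hY, he, hXY⟩ := h.indep_iff.1 hI.indep
    have hc := TwoSumIndep.ncard h hX hY he
    rw [← hXY] at hc
    rw [hI.rk_eq_ncard, hc]
    have hXA : X \ {e} ⊆ A := fun x hx => by
      have : x ∈ A ∪ B := hI.subset (by rw [hXY]; exact ⟨Or.inl hx.1, hx.2⟩)
      exact this.resolve_right fun h' => hx.2 (hMN x (hX.subset_ground hx.1) (hBN h'))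
    have hYB : Y \ {e} ⊆ B := fun x hx => by
      have : x ∈ A ∪ B := hI.subset (by rw [hXY]; exact ⟨Or.inr hx.1, hx.2⟩)
      exact this.resolve_left fun h' => hx.2 (hMN x (hAM h') (hY.subset_ground hx.1))
    have h1 : X.ncard ≤ M.rk (insert e A) := hX.ncard_le_rk (by
      rw [← singleton_union]; exact sdiff_subset_iff.1 hXA)
    have h2 : Y.ncard ≤ N.rk (insert e B) := hY.ncard_le_rk (by
      rw [← singleton_union]; exact sdiff_subset_iff.1 hYB)
    have h3 := (hX.subset sdiff_subset).ncard_le_rk hXA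
    have h4 := (hY.subset sdiff_subset).ncard_le_rk hYB
    rcases he with ⟨he, he'⟩ | ⟨he, he'⟩
    · have := ncard_sdiff_singleton_add_one he hX.finite_of_finite
      rw [sdiff_singleton_eq_self he'] at h4
      omega
    · have := ncard_sdiff_singleton_add_one he' hY.finite_of_finite
      rw [sdiff_singleton_eq_self he] at h3
      omega
  -- Lower bound: put `e` on either side. This gives `r(A + e) + r(B)` and `r(A) + r(B + e)`. Their
  -- maximum is the required minimum, because adding `e` raises each rank by zero or one.
  · obtain ⟨X, hX⟩ := M.exists_isBasis A
    obtain ⟨Y, hY⟩ := N.exists_isBasis B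
    have heX : e ∉ X := fun h => heA (hX.subset h)
    have heY : e ∉ Y := fun h => heB (hY.subset h)
    obtain ⟨X', hX', heX'⟩ := h.indep_left.subset_isBasis_of_subset
      (singleton_subset_iff.2 (mem_insert e A)) (insert_subset h.mem_left hAM)
    obtain ⟨Y', hY', heY'⟩ := h.indep_right.subset_isBasis_of_subset
      (singleton_subset_iff.2 (mem_insert e B)) (insert_subset h.mem_right hBN)
    rw [singleton_subset_iff] at heX' heY'
    have h1 := low X' Y hX'.indep hY.indep hX'.subset (hY.subset.trans (subset_insert _ _))
      (Or.inl ⟨heX', heY⟩)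
    have h2 := low X Y' hX.indep hY'.indep (hX.subset.trans (subset_insert _ _)) hY'.subset
      (Or.inr ⟨heX, heY'⟩)
    rw [← hX'.rk_eq_ncard, ← hY.rk_eq_ncard] at h1
    rw [← hX.rk_eq_ncard, ← hY'.rk_eq_ncard] at h2
    have h3 := N.rk_insert_le e B
    have h4 := M.rk_insert_le e A
    have h5 := N.rk_mono (subset_insert e B)
    have h6 := M.rk_mono (subset_insert e A)
    omega

theorem TwoSummable.rk_left (h : TwoSummable e M N) {A : Set α} (hA : A ⊆ M.E \ {e}) :
    (twoSum e M N).rk A = M.rk A := by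
  have := h.finite_left
  have h1 := h.rk_union hA (empty_subset _)
  have h2 := h.symm.rk_singleton
  have h3 := M.rk_mono (subset_insert e A)
  rw [union_empty, rk_empty, insert_empty_eq, h2] at h1
  omega

theorem TwoSummable.rk_right (h : TwoSummable e M N) {B : Set α} (hB : B ⊆ N.E \ {e}) :
    (twoSum e M N).rk B = N.rk B := by
  rw [h.twoSum_comm, h.symm.rk_left hB]

/-- Since `N.E \ {e}` spans `e`, the second term of the minimum in `rk_union` is attained. -/
theorem TwoSummable.rk_union_sdiff (h : TwoSummable e M N) {A : Set α} (hA : A ⊆ M.E \ {e}) :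
    (twoSum e M N).rk (A ∪ (N.E \ {e})) + 1 = M.rk (insert e A) + N.rk N.E := by
  have := h.finite_left
  have h1 := h.rk_union hA Subset.rfl
  have h2 := M.rk_insert_le e A
  rw [insert_sdiff_self_of_mem h.mem_right, h.symm.rk_sdiff] at h1
  omega

theorem TwoSummable.exists_mem_ne (h : TwoSummable e M N) : ∃ x ∈ M.E, x ≠ e := by
  have := h.finite_left
  obtain ⟨x, hx, hxe⟩ := exists_ne_of_one_lt_ncard (s := M.E) (by have := h.two_le_left; omega) e
  exact ⟨x, hx, hxe⟩

end TwoSum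

end Matroid

/-! ## Envelope classes and 2-sums -/

namespace Matroid

/-! ### Splitting a matroid along a 2-separation -/

section Split

variable {α : Type*} {R : Matroid α}

/-- The independent sets of the left summand in the splitting of `R` along `(X, Y)` with new
basepoint `e`. -/
def SplitIndep (R : Matroid α) (X Y : Set α) (e : α) (I : Set α) : Prop :=
  I ⊆ insert e X ∧ R.Indep (I \ {e}) ∧ (e ∈ I → (I \ {e}).ncard + R.rk Y ≤ R.rk (I \ {e} ∪ Y))

theorem rk_union_le_of_indep [R.Finite] {I : Set α} (hI : R.Indep I) (Y : Set α) :
    R.rk (I ∪ Y) ≤ I.ncard + R.rk Y := by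
  have h1 := R.rk_inter_add_rk_union_le I Y
  rw [hI.rk_eq_ncard] at h1
  omega

theorem indep_insert_of_rk [R.Finite] {I : Set α} {x : α} (hI : R.Indep I) (hx : x ∉ I)
    (h : R.rk (insert x I) = R.rk I + 1) : R.Indep (insert x I) := by
  refine indep_of_ncard_le_rk (hI.finite_of_finite.insert x) ?_
  rw [ncard_insert_of_notMem hx hI.finite_of_finite, h, hI.rk_eq_ncard]

/-- An element that raises the rank of a set raises the rank of each of its subsets. -/
theorem rk_insert_of_subset [R.Finite] {I Z : Set α} {x : α} (hIZ : I ⊆ Z)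
    (h : R.rk (insert x Z) = R.rk Z + 1) : R.rk (insert x I) = R.rk I + 1 := by
  have hxZ : x ∉ Z := fun hx => by rw [insert_eq_of_mem hx] at h; omega
  have h1 := R.rk_inter_add_rk_union_le (insert x I) Z
  rw [insert_inter_of_notMem hxZ, inter_eq_left.2 hIZ, insert_union, union_eq_right.2 hIZ] at h1
  have h2 := R.rk_insert_le x I
  omega

/-- In a linear picture, the spans of `X` and `Y` meet in a line through the origin, and `e` is a
vector on it. So `e` can be added to an independent `I ⊆ X` exactly when `I` is independent in the
contraction of `R` by `Y`. Augmentation takes place in `R` if neither set contains `e`, and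
otherwise mostly in that contraction. -/
theorem SplitIndep.aug [R.Finite] {X Y : Set α} {e : α} (hXY : X ∪ Y = R.E)
    (hr : R.rk X + R.rk Y = R.rk R.E + 1) {I J : Set α} (hI : SplitIndep R X Y e I)
    (hJ : SplitIndep R X Y e J) (hlt : I.ncard < J.ncard) :
    ∃ x ∈ J, x ∉ I ∧ SplitIndep R X Y e (insert x I) := by
  obtain ⟨hIX, hIi, hIe⟩ := hI
  obtain ⟨hJX, hJi, hJe⟩ := hJ
  have hfin : ∀ K, R.Indep (K \ {e}) → K.Finite := fun K hK =>
    (hK.finite_of_finite.insert e).subset (by simp [insert_sdiff_singleton])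
  have hIf := hfin I hIi
  have hJf := hfin J hJi
  -- augmentation by an element that raises the rank of `I \ {e} ∪ Y`
  have key : R.rk (I \ {e} ∪ Y) < R.rk (J \ {e} ∪ Y) →
      ∃ x ∈ J, x ∉ I ∧ SplitIndep R X Y e (insert x I) := by
    intro h
    obtain ⟨x, hx, hx', hrx⟩ := exists_rk_insert_of_lt h
    have hxJ : x ∈ J \ {e} := hx.resolve_right fun h => hx' (Or.inr h)
    have hxI : x ∉ I := fun h => hx' (Or.inl ⟨h, hxJ.2⟩)
    have hxI' : x ∉ I \ {e} := fun h => hxI h.1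
    refine ⟨x, hxJ.1, hxI, insert_subset (hJX hxJ.1) hIX, ?_, fun h => ?_⟩
    · rw [insert_sdiff_of_notMem _ hxJ.2]
      exact indep_insert_of_rk hIi hxI' (rk_insert_of_subset subset_union_left hrx)
    · rw [insert_sdiff_of_notMem _ hxJ.2, ncard_insert_of_notMem hxI' hIi.finite_of_finite,
        insert_union, hrx]
      have := hIe (h.resolve_left fun h => hxJ.2 h.symm)
      omega
  have hIY := rk_union_le_of_indep hIi Y
  by_cases heI : e ∈ I
  · have c1 := ncard_sdiff_singleton_add_one heI hIf
    have h1 := hIe heI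
    refine key ?_
    by_cases heJ : e ∈ J
    · have c2 := ncard_sdiff_singleton_add_one heJ hJf
      have := hJe heJ
      omega
    · rw [sdiff_singleton_eq_self heJ] at hJi ⊢
      -- Submodularity and `hr` give `r(J ∪ Y) ≥ |J| + r(Y) - 1`: contracting `Y` costs `J` at most
      -- one.
      have h2 := R.rk_inter_add_rk_union_le X (J ∪ Y)
      have h3 : J ⊆ X ∩ (J ∪ Y) := fun x hx =>
        ⟨(hJX hx).resolve_left fun h => heJ (h ▸ hx), Or.inl hx⟩
      have h4 : R.E ⊆ X ∪ (J ∪ Y) := by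
        rw [← hXY]; exact union_subset_union_right _ subset_union_right
      have h5 := hJi.ncard_le_rk h3
      have h6 := R.rk_mono h4
      omega
  · rw [sdiff_singleton_eq_self heI] at hIi hIY key
    by_cases heJ : e ∈ J
    · have c2 := ncard_sdiff_singleton_add_one heJ hJf
      have h1 := hJe heJ
      -- Either `e` itself can be added to `I`, or `I` is dependent modulo `Y` and `r(I ∪ Y)` is
      -- smaller than `r(J \ {e} ∪ Y)`.
      by_cases h2 : I.ncard + R.rk Y ≤ R.rk (I ∪ Y)
      · refine ⟨e, heJ, heI, insert_subset (mem_insert _ _) hIX, ?_, fun _ => ?_⟩ <;>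
          rwa [insert_sdiff_self_of_notMem heI]
      · exact key (by omega)
    · rw [sdiff_singleton_eq_self heJ] at hJi
      have h0 : R.rk I < R.rk J := by rwa [hIi.rk_eq_ncard, hJi.rk_eq_ncard]
      obtain ⟨x, hx, hx', hrx⟩ := exists_rk_insert_of_lt h0
      have hxe : x ≠ e := fun h => heJ (h ▸ hx)
      refine ⟨x, hx, hx', insert_subset (hJX hx) hIX, ?_, fun h => ?_⟩
      · rw [insert_sdiff_of_notMem _ (by simpa using hxe), sdiff_singleton_eq_self heI]
        exact indep_insert_of_rk hIi hx' hrx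
      · exact absurd (h.resolve_left hxe.symm) heI

/-- A matroid with a 2-separation `(X, Y)` has a matroid on `insert e X` as a 2-sum summand. -/
theorem exists_split [R.Finite] {X Y : Set α} {e : α} (he : e ∉ R.E) (hXY : X ∪ Y = R.E)
    (hr : R.rk X + R.rk Y = R.rk R.E + 1) :
    ∃ M : Matroid α, M.Finite ∧ M.E = insert e X ∧ (∀ A ⊆ X, M.rk A = R.rk A) ∧
      ∀ A ⊆ X, M.rk (insert e A) + R.rk Y = R.rk (A ∪ Y) + 1 := by
  have hXE : X ⊆ R.E := hXY ▸ subset_union_left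
  have hYE : Y ⊆ R.E := hXY ▸ subset_union_right
  have heX : e ∉ X := fun h => he (hXE h)
  have hf : (insert e X).Finite := (R.ground_finite.subset hXE).insert e
  let M₀ : IndepMatroid α := IndepMatroid.ofFinite hf (SplitIndep R X Y e)
    ⟨empty_subset _, by simp, fun h => absurd h (notMem_empty e)⟩
    (by
      rintro I J ⟨hJX, hJi, hJe⟩ hIJ
      have hs : I \ {e} ⊆ J \ {e} := sdiff_subset_sdiff_left hIJ
      refine ⟨hIJ.trans hJX, hJi.subset hs, fun heI => ?_⟩
      have h1 := hJe (hIJ heI)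
      -- Removing elements lowers the rank of the union with `Y` by at most their number.
      have h2 := rk_union_le_of_indep (hJi.subset (sdiff_subset (t := I \ {e}))) (I \ {e} ∪ Y)
      rw [← union_assoc, sdiff_union_of_subset hs] at h2
      have h3 := ncard_sdiff_add_ncard_of_subset hs hJi.finite_of_finite
      omega)
    (fun I J hI hJ hlt => SplitIndep.aug hXY hr hI hJ hlt)
    (fun I hI => hI.1)
  have hM₀ : ∀ I, M₀.matroid.Indep I ↔ SplitIndep R X Y e I := fun _ => Iff.rfl
  have hfin : M₀.matroid.Finite := ⟨hf⟩
  have hind : ∀ I ⊆ X, M₀.matroid.Indep I ↔ R.Indep I := by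
    intro I hI
    have heI : e ∉ I := fun h => heX (hI h)
    rw [hM₀, SplitIndep, sdiff_singleton_eq_self heI]
    exact ⟨fun h => h.2.1, fun h => ⟨hI.trans (subset_insert _ _), h, fun h => absurd h heI⟩⟩
  refine ⟨M₀.matroid, hfin, rfl, fun A hA => ?_, fun A hA => ?_⟩
  · apply le_antisymm
    · obtain ⟨I, hI⟩ := M₀.matroid.exists_isBasis A (hA.trans (subset_insert _ _))
      rw [hI.rk_eq_ncard]
      exact ((hind I (hI.subset.trans hA)).1 hI.indep).ncard_le_rk hI.subset
    · obtain ⟨I, hI⟩ := R.exists_isBasis A (hA.trans hXE)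
      rw [hI.rk_eq_ncard]
      exact ((hind I (hI.subset.trans hA)).2 hI.indep).ncard_le_rk hI.subset
  · apply le_antisymm
    · have hei : M₀.matroid.Indep {e} :=
        (hM₀ _).2 ⟨singleton_subset_iff.2 (mem_insert _ _), by simp, by simp⟩
      obtain ⟨I, hI, heI⟩ := hei.subset_isBasis_of_subset
        (singleton_subset_iff.2 (mem_insert e A)) (insert_subset_insert hA)
      rw [singleton_subset_iff] at heI
      have h1 := ((hM₀ I).1 hI.indep).2.2 heI
      have h2 := ncard_sdiff_singleton_add_one heI hI.indep.finite_of_finite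
      have h3 : I \ {e} ∪ Y ⊆ A ∪ Y := union_subset_union_left _ (by
        rw [sdiff_subset_iff, singleton_union]; exact hI.subset)
      have h4 := R.rk_mono h3
      rw [hI.rk_eq_ncard]
      omega
    -- A basis `K` of `A ∪ Y` extending a basis `J` of `Y` leaves `K \ J`, a basis of `A` modulo
    -- `Y`, to which `e` can be added.
    · obtain ⟨J, hJ⟩ := R.exists_isBasis Y
      obtain ⟨K, hK, hJK⟩ := hJ.indep.subset_isBasis_of_subset
        (hJ.subset.trans (subset_union_right (s := A))) (union_subset (hA.trans hXE) hYE)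
      have hKA : K \ J ⊆ A := fun x hx => (hK.subset hx.1).resolve_right fun hxY =>
        hx.2 (hJ.mem_of_insert_indep hxY (hK.indep.subset (insert_subset hx.1 hJK)))
      have heK : e ∉ K \ J := fun h => heX (hA (hKA h))
      have hc := ncard_sdiff_add_ncard_of_subset hJK hK.indep.finite_of_finite
      have h1 : M₀.matroid.Indep (insert e (K \ J)) := by
        rw [hM₀]
        refine ⟨insert_subset_insert (hKA.trans hA), ?_, fun _ => ?_⟩
        · rw [insert_sdiff_self_of_notMem heK]
          exact hK.indep.subset sdiff_subset
        · rw [insert_sdiff_self_of_notMem heK, hJ.rk_eq_ncard, hc]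
          refine hK.indep.ncard_le_rk fun x hx => ?_
          by_cases hxJ : x ∈ J
          · exact Or.inr (hJ.subset hxJ)
          · exact Or.inl ⟨hx, hxJ⟩
      have h2 := h1.ncard_le_rk (insert_subset_insert hKA)
      rw [ncard_insert_of_notMem heK (hK.indep.subset sdiff_subset).finite_of_finite] at h2
      rw [hJ.rk_eq_ncard, hK.rk_eq_ncard]
      omega

end Split

/-! ### Ranks of arcs in 2-sums and in their summands -/

section Envelope

variable {α : Type*} [LinearOrder α] {M N P Q R : Matroid α} {e : α}

/-- The connectivity of `{e}` involves only the ranks of `{e}`, its complement and the ground set,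
all of which are arcs. -/
theorem TwoSummable.of_rk_eq (h : TwoSummable e P Q) (hM : M.Finite) (hN : N.Finite)
    (hPM : P.E = M.E) (hQN : Q.E = N.E) (hPr : ∀ I, IsArc P.E I → P.rk I = M.rk I)
    (hQr : ∀ I, IsArc Q.E I → Q.rk I = N.rk I) : TwoSummable e M N := by
  refine ⟨hM, hN, hPM ▸ h.two_le_left, hQN ▸ h.two_le_right, by
    rw [← hPM, ← hQN, h.inter_eq], fun hs => h.not_sep_left ?_, fun hs => h.not_sep_right ?_⟩
  · rw [IsSeparation, connectivity_eq, ← hPM, ← hPr _ (isArc_singleton h.mem_left),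
      ← hPr _ isArc_sdiff_singleton, ← hPr _ (isArc_self _)] at hs
    rwa [IsSeparation, connectivity_eq]
  · rw [IsSeparation, connectivity_eq, ← hQN, ← hQr _ (isArc_singleton h.mem_right),
      ← hQr _ isArc_sdiff_singleton, ← hQr _ (isArc_self _)] at hs
    rwa [IsSeparation, connectivity_eq]

/-- If `I` is an arc of the ground set of the 2-sum, then it is an arc on the left side together
with the basepoint, if it meets the right side. -/
theorem _root_.IsArc.insert_inter {E F I : Set α} (hEF : NonCrossing E F) (he : E ∩ F = {e})
    (h : IsArc ((E ∪ F) \ {e}) I) {q : α} (hq : q ∈ F) (hqe : q ≠ e) (hqI : q ∈ I) :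
    IsArc E (insert e (I ∩ (E \ {e}))) := by
  convert h.pullback hEF he hq hqe using 1
  have heE : e ∈ E := (he.symm ▸ mem_singleton e : e ∈ E ∩ F).1
  ext x
  simp only [mem_insert_iff, mem_inter_iff, mem_sdiff, mem_singleton_iff, mem_ofPred_eq]
  by_cases hx : x = e
  · subst hx; tauto
  · tauto

theorem _root_.IsArc.inter_sdiff {E F I : Set α} (hEF : NonCrossing E F) (he : E ∩ F = {e})
    (h : IsArc ((E ∪ F) \ {e}) I) {q : α} (hq : q ∈ F) (hqe : q ≠ e) (hqI : q ∉ I) :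
    IsArc E (I ∩ (E \ {e})) := by
  convert h.pullback hEF he hq hqe using 1
  ext x
  simp only [mem_inter_iff, mem_sdiff, mem_singleton_iff, mem_ofPred_eq]
  tauto

/-- Let `A` and `B` be the parts of `I` on the two sides. Then `A + e` is an arc if `I` contains a
point of the other side, and `A` is an arc if `I` misses one; likewise for `B`. If `I` meets and
misses both sides, all terms of the rank formula are ranks of arcs. If it contains or avoids a whole
side, the formula collapses to terms that still are. -/
theorem TwoSummable.rk_arc_eq (h : TwoSummable e P Q) (h' : TwoSummable e M N)
    (hPM : P.E = M.E) (hQN : Q.E = N.E) (hPQ : NonCrossing P.E Q.E)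
    (hPr : ∀ I, IsArc P.E I → P.rk I = M.rk I) (hQr : ∀ I, IsArc Q.E I → Q.rk I = N.rk I)
    {I : Set α} (hI : IsArc ((P.E ∪ Q.E) \ {e}) I) :
    (twoSum e P Q).rk I = (twoSum e M N).rk I := by
  have hI' : IsArc ((Q.E ∪ P.E) \ {e}) I := by rwa [union_comm]
  have he : P.E ∩ Q.E = {e} := h.inter_eq
  have he' : Q.E ∩ P.E = {e} := h.symm.inter_eq
  have hQP := hPQ.symm
  set A := I ∩ (P.E \ {e}) with hA
  set B := I ∩ (Q.E \ {e}) with hB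
  have hAB : I = A ∪ B := by
    rw [hA, hB, ← inter_union_distrib_left, ← union_sdiff_distrib, eq_comm, inter_eq_left]
    exact hI.1
  have hAP : A ⊆ P.E \ {e} := inter_subset_right
  have hBQ : B ⊆ Q.E \ {e} := inter_subset_right
  have hAM : A ⊆ M.E \ {e} := hPM ▸ hAP
  have hBN : B ⊆ N.E \ {e} := hQN ▸ hBQ
  obtain ⟨p₀, hp₀, hp₀e⟩ := h.exists_mem_ne
  obtain ⟨q₀, hq₀, hq₀e⟩ := h.symm.exists_mem_ne
  have hQE := hQr _ (isArc_self _)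
  have hPE := hPr _ (isArc_self _)
  by_cases h1 : ∃ q ∈ Q.E, q ≠ e ∧ q ∈ I
  swap
  · have hB0 : B = ∅ := by
      rw [eq_empty_iff_forall_notMem]
      exact fun x hx => h1 ⟨x, hx.2.1, hx.2.2, hx.1⟩
    rw [hAB, hB0, union_empty, h.rk_left hAP, h'.rk_left hAM]
    exact hPr _ (hI.inter_sdiff hPQ he hq₀ hq₀e fun h => h1 ⟨q₀, hq₀, hq₀e, h⟩)
  by_cases h2 : ∃ p ∈ P.E, p ≠ e ∧ p ∈ I
  swap
  · have hA0 : A = ∅ := by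
      rw [eq_empty_iff_forall_notMem]
      exact fun x hx => h2 ⟨x, hx.2.1, hx.2.2, hx.1⟩
    rw [hAB, hA0, empty_union, h.rk_right hBQ, h'.rk_right hBN]
    exact hQr _ (hI'.inter_sdiff hQP he' hp₀ hp₀e fun h => h2 ⟨p₀, hp₀, hp₀e, h⟩)
  obtain ⟨q, hq, hqe, hqI⟩ := h1
  obtain ⟨p, hp, hpe, hpI⟩ := h2
  have r1 : P.rk (insert e A) = M.rk (insert e A) := hPr _ (hI.insert_inter hPQ he hq hqe hqI)
  have r2 : Q.rk (insert e B) = N.rk (insert e B) := hQr _ (hI'.insert_inter hQP he' hp hpe hpI)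
  by_cases h3 : ∃ q ∈ Q.E, q ≠ e ∧ q ∉ I
  swap
  · have hB1 : B = Q.E \ {e} := subset_antisymm hBQ fun x hx =>
      ⟨by by_contra hxI; exact h3 ⟨x, hx.1, hx.2, hxI⟩, hx⟩
    have k1 := h.rk_union_sdiff hAP
    have k2 := h'.rk_union_sdiff hAM
    rw [← hQN] at k2
    rw [hAB, hB1]
    omega
  by_cases h4 : ∃ p ∈ P.E, p ≠ e ∧ p ∉ I
  swap
  · have hA1 : A = P.E \ {e} := subset_antisymm hAP fun x hx =>
      ⟨by by_contra hxI; exact h4 ⟨x, hx.1, hx.2, hxI⟩, hx⟩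
    have k1 := h.symm.rk_union_sdiff hBQ
    have k2 := h'.symm.rk_union_sdiff hBN
    rw [← hPM] at k2
    rw [hAB, hA1, union_comm, h.twoSum_comm, h'.twoSum_comm]
    omega
  obtain ⟨q', hq', hqe', hqI'⟩ := h3
  obtain ⟨p', hp', hpe', hpI'⟩ := h4
  have r3 : P.rk A = M.rk A := hPr _ (hI.inter_sdiff hPQ he hq' hqe' hqI')
  have r4 : Q.rk B = N.rk B := hQr _ (hI'.inter_sdiff hQP he' hp' hpe' hpI')
  have k1 := h.rk_union hAP hBQ
  have k2 := h'.rk_union hAM hBN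
  rw [hAB]
  omega

/-- The summand of a matroid with the necklace of a 2-sum has the ranks of arcs of the summand of
the 2-sum. -/
theorem TwoSummable.rk_split_eq (h : TwoSummable e P Q) (hPQ : NonCrossing P.E Q.E)
    (hR : ∀ I, IsArc ((P.E ∪ Q.E) \ {e}) I → (twoSum e P Q).rk I = R.rk I)
    (hM : ∀ A ⊆ P.E \ {e}, M.rk A = R.rk A)
    (hMe : ∀ A ⊆ P.E \ {e}, M.rk (insert e A) + R.rk (Q.E \ {e}) = R.rk (A ∪ Q.E \ {e}) + 1)
    {I : Set α} (hI : IsArc P.E I) : P.rk I = M.rk I := by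
  have he : P.E ∩ Q.E = {e} := h.inter_eq
  have hexp := hI.expand hPQ he
  have hIP : I \ {e} ⊆ P.E \ {e} := sdiff_subset_sdiff_left hI.1
  -- The expansion of `I` is `I \ {e} ∪ Q.E \ {e}` or `I` itself. In the first case `hMe` and
  -- `rk_union_sdiff` express the ranks of `I` in `M` and in `P` by the same ranks of arcs.
  by_cases heI : e ∈ I
  · have h1 : {x | x ≠ e ∧ (x ∈ P.E ∧ x ∈ I ∨ x ∈ Q.E ∧ e ∈ I)} = I \ {e} ∪ Q.E \ {e} := by
      ext x
      have := @hI.1 x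
      simp only [mem_union, mem_sdiff, mem_singleton_iff, mem_ofPred_eq]
      tauto
    rw [h1] at hexp
    have hQarc : IsArc ((P.E ∪ Q.E) \ {e}) (Q.E \ {e}) :=
      ⟨sdiff_subset_sdiff_left subset_union_right, hPQ.symm.mono sdiff_subset (by
        rintro x ⟨⟨hx, hxe⟩, hx'⟩
        exact hx.resolve_right fun h => hx' ⟨h, hxe⟩)⟩
    have k1 := hR _ hexp
    have k2 := hR _ hQarc
    have k3 := hMe _ hIP
    have k4 := h.rk_union_sdiff hIP
    have k5 := h.rk_right (Subset.rfl : Q.E \ {e} ⊆ Q.E \ {e})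
    have k6 := h.symm.rk_sdiff
    rw [insert_sdiff_self_of_mem heI] at k3 k4
    omega
  · have h1 : {x | x ≠ e ∧ (x ∈ P.E ∧ x ∈ I ∨ x ∈ Q.E ∧ e ∈ I)} = I := by
      ext x
      have := @hI.1 x
      have : x ∈ I → x ≠ e := fun hx hxe => heI (hxe ▸ hx)
      simp only [mem_ofPred_eq]
      tauto
    rw [h1] at hexp
    rw [sdiff_singleton_eq_self heI] at hIP
    rw [hM I hIP, ← hR I hexp, h.rk_left hIP]

/-- A matroid with the same ranks of arcs as a 2-sum of matroids on non-crossing sets is a 2-sum of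
matroids with the same ranks of arcs as the summands. -/
theorem TwoSummable.exists_eq_twoSum (h : TwoSummable e P Q) (hPQ : NonCrossing P.E Q.E)
    (hRf : R.Finite) (hRE : R.E = (P.E ∪ Q.E) \ {e})
    (hR : ∀ I, IsArc ((P.E ∪ Q.E) \ {e}) I → (twoSum e P Q).rk I = R.rk I) :
    ∃ M N : Matroid α, M.Finite ∧ N.Finite ∧ P.E = M.E ∧ Q.E = N.E ∧
      (∀ I, IsArc P.E I → P.rk I = M.rk I) ∧ (∀ I, IsArc Q.E I → Q.rk I = N.rk I) ∧
      R = twoSum e M N := by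
  have he : P.E ∩ Q.E = {e} := h.inter_eq
  have heR : e ∉ R.E := by rw [hRE]; exact fun h => h.2 rfl
  have hXY : (P.E \ {e}) ∪ (Q.E \ {e}) = R.E := by rw [hRE, union_sdiff_distrib]
  have hd : Disjoint (P.E \ {e}) (Q.E \ {e}) := by
    rw [Set.disjoint_left]
    rintro x ⟨hx, hxe⟩ hx'
    exact hxe (he ▸ ⟨hx, hx'.1⟩)
  have hQarc : IsArc ((P.E ∪ Q.E) \ {e}) (Q.E \ {e}) :=
    ⟨sdiff_subset_sdiff_left subset_union_right, hPQ.symm.mono sdiff_subset (by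
      rintro x ⟨⟨hx, hxe⟩, hx'⟩
      exact hx.resolve_right fun h => hx' ⟨h, hxe⟩)⟩
  have hParc : IsArc ((P.E ∪ Q.E) \ {e}) (P.E \ {e}) :=
    ⟨sdiff_subset_sdiff_left subset_union_left, hPQ.mono sdiff_subset (by
      rintro x ⟨⟨hx, hxe⟩, hx'⟩
      exact hx.resolve_left fun h => hx' ⟨h, hxe⟩)⟩
  -- Both sides and the whole ground set are arcs, so `R` inherits this equation from the 2-sum.
  have hr : R.rk (P.E \ {e}) + R.rk (Q.E \ {e}) = R.rk R.E + 1 := by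
    have k1 := h.rk_union_sdiff (Subset.rfl : P.E \ {e} ⊆ P.E \ {e})
    rw [hXY, insert_sdiff_self_of_mem h.mem_left] at k1
    rw [← hR _ hParc, ← hR _ hQarc, h.rk_left Subset.rfl, h.rk_right Subset.rfl, h.rk_sdiff,
      h.symm.rk_sdiff, ← k1, hRE, hR _ (isArc_self _)]
  obtain ⟨M, hMf, hME, hM, hMe⟩ := exists_split heR hXY hr
  obtain ⟨N, hNf, hNE, hN, hNe⟩ := exists_split heR ((union_comm _ _).trans hXY)
    ((add_comm _ _).trans hr)
  rw [insert_sdiff_self_of_mem h.mem_left] at hME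
  rw [insert_sdiff_self_of_mem h.mem_right] at hNE
  have hPr : ∀ I, IsArc P.E I → P.rk I = M.rk I := fun I hI => h.rk_split_eq hPQ hR hM hMe hI
  have hQr : ∀ I, IsArc Q.E I → Q.rk I = N.rk I := fun I hI =>
    h.symm.rk_split_eq hPQ.symm (fun I hI => by
      rw [← h.twoSum_comm]; exact hR I (by rwa [union_comm])) hN hNe hI
  refine ⟨M, N, hMf, hNf, hME.symm, hNE.symm, hPr, hQr, ?_⟩
  have h' : TwoSummable e M N := h.of_rk_eq hMf hNf hME.symm hNE.symm hPr hQr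
  have := h'.finite
  refine ext_rk (by rw [hRE, h'.ground_eq, hME, hNE]) fun X hX => ?_
  set A := X ∩ (P.E \ {e})
  set B := X ∩ (Q.E \ {e})
  have hAP : A ⊆ P.E \ {e} := inter_subset_right
  have hBQ : B ⊆ Q.E \ {e} := inter_subset_right
  have hAB : X = A ∪ B := by rw [← inter_union_distrib_left, hXY, inter_eq_left.2 hX]
  have k1 := h'.rk_union (A := A) (B := B) (by rwa [hME]) (by rwa [hNE])
  rw [hM A hAP, hN B hBQ, ← hAB] at k1
  have k2 := hMe A hAP
  have k3 := hNe B hBQ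
  -- By `hMe`, `hNe` and `hr`, the 2-sum of `M` and `N` gives `X` the rank `min s t` with `s = r(A)
  -- + r(B)` and `t = r(A ∪ Q.E \ {e}) + r(B ∪ P.E \ {e}) - r(R.E)`, ranks taken in `R`. `k4` and
  -- `k7` give `r(X) ≤ s` and `r(X) ≤ t`, while `k5` and `k6` add up to `s + t ≤ 2 r(X) + 1`.
  -- Integrality forces `min s t = r(X)`.
  have k4 := R.rk_inter_add_rk_union_le A B
  have k5 := R.rk_inter_add_rk_union_le X (Q.E \ {e})
  have k6 := R.rk_inter_add_rk_union_le X (P.E \ {e})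
  have k7 := R.rk_inter_add_rk_union_le (A ∪ Q.E \ {e}) (B ∪ P.E \ {e})
  have e5 : X ∪ Q.E \ {e} = A ∪ Q.E \ {e} := by
    rw [hAB, union_assoc, union_eq_right.2 hBQ]
  have e6 : X ∪ P.E \ {e} = B ∪ P.E \ {e} := by
    rw [hAB, union_comm A, union_assoc, union_eq_right.2 hAP]
  have e7 : (A ∪ Q.E \ {e}) ∩ (B ∪ P.E \ {e}) = X := by
    rw [union_inter_distrib_right, inter_union_distrib_left, inter_union_distrib_left,
      inter_eq_left.2 hAP, inter_comm (Q.E \ {e}) B, inter_eq_left.2 hBQ, hd.symm.inter_eq,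
      union_empty, union_eq_right.2 inter_subset_left, ← hAB]
  have e8 : (A ∪ Q.E \ {e}) ∪ (B ∪ P.E \ {e}) = R.E := by
    rw [← hXY, union_union_union_comm, ← hAB, union_comm (Q.E \ {e}), union_eq_right, hXY]
    exact hX
  have e9 : X ∩ (Q.E \ {e}) = B := rfl
  have e10 : X ∩ (P.E \ {e}) = A := rfl
  rw [e5, e9] at k5
  rw [e6, e10] at k6
  rw [e7, e8] at k7
  rw [← hAB] at k4
  omega

end Envelope

end Matroid

/-! ## Positive realizations with respect to a strict total order -/

section Enumeration

variable {α : Type*}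

instance [LinearOrder α] (w : α) : IsStrictTotalOrder α (ShiftLT w) where
  trichotomous a b h h' := ((shiftLT_trichotomy w a b).resolve_left h).resolve_right h'
  irrefl a := not_shiftLT_self w a
  trans _ _ _ h h' := h.trans h'

theorem exists_minimal_of_finite (lt : α → α → Prop) [IsStrictTotalOrder α lt] {I : Set α}
    (hI : I.Finite) (hne : I.Nonempty) : ∃ x ∈ I, ∀ y ∈ I, y ≠ x → lt x y := by
  have : Finite I := hI.to_subtype
  have : IsTrans I (fun a b => lt a.1 b.1) := ⟨fun _ _ _ => _root_.trans⟩
  have : Std.Irrefl (fun a b : I => lt a.1 b.1) := ⟨fun a => irrefl a.1⟩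
  obtain ⟨x, -, hx⟩ := (Finite.wellFounded_of_trans_of_irrefl
    (fun a b : I => lt a.1 b.1)).has_min univ ⟨⟨_, hne.some_mem⟩, mem_univ _⟩
  refine ⟨x.1, x.2, fun y hy hyx => ?_⟩
  by_contra h
  exact hyx (Std.Trichotomous.trichotomous (r := lt) y x.1 (hx ⟨y, hy⟩ (mem_univ _)) h)

/-- A finite set can be enumerated increasingly with respect to a strict total order. -/
theorem exists_increasing_enumeration (lt : α → α → Prop) [IsStrictTotalOrder α lt] :
    ∀ (r : ℕ) (B : Set α), B.Finite → B.ncard = r →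
      ∃ c : Fin r → α, (∀ i j, i < j → lt (c i) (c j)) ∧ range c = B
  | 0, B, hB, hr => by
    refine ⟨Fin.elim0, fun i => i.elim0, ?_⟩
    rw [(ncard_eq_zero hB).1 hr, range_eq_empty]
  | r + 1, B, hB, hr => by
    have hne : B.Nonempty := nonempty_of_ncard_ne_zero (by omega)
    obtain ⟨x, hx, hmin⟩ := exists_minimal_of_finite lt hB hne
    have hc := ncard_sdiff_singleton_add_one hx hB
    obtain ⟨c, hc, hcB⟩ := exists_increasing_enumeration lt r (B \ {x}) (hB.subset sdiff_subset)
      (by omega)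
    refine ⟨Fin.cons x c, fun i j => ?_, ?_⟩
    · refine Fin.cases ?_ (fun i => ?_) i <;> refine Fin.cases ?_ (fun j => ?_) j
      · exact fun h => absurd h (lt_irrefl _)
      · intro _
        have : c j ∈ B \ {x} := hcB ▸ mem_range_self j
        simpa using hmin _ this.1 this.2
      · exact fun h => absurd h (Fin.not_lt_zero _)
      · intro h
        simpa using hc i j (by simpa using h)
    · rw [Fin.range_cons, hcB, insert_sdiff_singleton, insert_eq_of_mem hx]

theorem ncard_range_of_increasing {lt : α → α → Prop} [IsStrictTotalOrder α lt] {r : ℕ}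
    {c : Fin r → α} (hc : ∀ i j, i < j → lt (c i) (c j)) : (range c).ncard = r := by
  rw [ncard_range_of_injective (injective_of_increasing (· < ·) lt c (hc _ _)), Nat.card_fin]

/-- A lower set of `Fin r` is an initial segment. -/
theorem Fin.exists_forall_iff_lt {r : ℕ} (q : Fin r → Prop) (hq : ∀ i j, i < j → q j → q i) :
    ∃ k ≤ r, ∀ i : Fin r, q i ↔ i.1 < k := by
  classical
  have hex : ∃ k, ∀ i : Fin r, q i → i.1 < k := ⟨r, fun i _ => i.2⟩
  refine ⟨Nat.find hex, Nat.find_le fun i _ => i.2, fun i => ⟨Nat.find_spec hex i, fun hi => ?_⟩⟩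
  by_contra hqi
  refine Nat.find_min hex hi fun j hj => ?_
  by_contra hij
  rcases lt_or_eq_of_le (not_lt.1 hij) with h | h
  · exact hqi (hq i j h hj)
  · exact hqi ((Fin.ext h : i = j) ▸ hj)

end Enumeration

theorem Matrix.det_ne_zero_iff_linearIndepOn_range {ι : Type*} {r : ℕ} (f : ι → Fin r → ℝ)
    {c : Fin r → ι} (hc : Function.Injective c) :
    (Matrix.of fun i j => f (c j) i).det ≠ 0 ↔ LinearIndepOn ℝ f (range c) := by
  rw [linearIndepOn_range_iff hc, ← isUnit_iff_ne_zero, ← Matrix.isUnit_iff_isUnit_det,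
    ← Matrix.linearIndependent_cols_iff_isUnit]
  rfl

theorem LinearIndepOn.ncard_eq_of_span_eq_top {ι : Type*} {r : ℕ} {f : ι → Fin r → ℝ} {b : Set ι}
    (hb : LinearIndepOn ℝ f b) (hs : Submodule.span ℝ (f '' b) = ⊤) : b.ncard = r := by
  have h1 : ⊤ ≤ Submodule.span ℝ (range fun x : b => f x) := by
    rw [← hs, image_eq_range]
  have := Module.finrank_eq_nat_card_basis (Module.Basis.mk hb h1)
  rw [Module.finrank_fin_fun] at this
  exact this.symm

namespace Matroid

section PosRep

variable {α : Type*} {M : Matroid α} {lt : α → α → Prop} {r : ℕ} {v : α → Fin r → ℝ}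

/-- The vectors `v x` realize `M`, and the determinants of their increasing sequences of length
`r` are nonnegative. -/
def IsPosRep (M : Matroid α) (lt : α → α → Prop) (r : ℕ) (v : α → Fin r → ℝ) : Prop :=
  ∀ c : Fin r → α, (∀ i, c i ∈ M.E) → (∀ i j, i < j → lt (c i) (c j)) →
    0 ≤ (Matrix.of fun i j => v (c j) i).det ∧
      ((Matrix.of fun i j => v (c j) i).det ≠ 0 ↔ M.IsBase (range c))

theorem IsPositroid.exists_isPosRep [LinearOrder α] (h : M.IsPositroid) :
    ∃ r v, M.eRank = (r : ℕ) ∧ M.IsPosRep (· < ·) r v := by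
  classical
  obtain ⟨hf, r, A, hr, hA, hpos⟩ := h
  -- The value zero off the ground set plays no role, as only sequences in `M.E` are tested.
  refine ⟨r, fun x i => if hx : x ∈ M.E then A i ⟨x, hx⟩ else 0, hr, fun c hcE hc => ?_⟩
  let c' : Fin r ↪o M.E := OrderEmbedding.ofStrictMono (fun i => ⟨c i, hcE i⟩) fun i j h => hc i j h
  have h1 : (Matrix.of fun i j => if hx : c j ∈ M.E then A i ⟨c j, hx⟩ else 0) =
      A.submatrix id c' := by
    ext i j
    simp only [hcE j, Matrix.of_apply, dif_pos]
    rfl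
  have h3 : Subtype.val '' range c' = range c := by
    rw [← range_comp]; rfl
  have hcr : (range c).ncard = r := ncard_range_of_increasing hc
  rw [h1]
  refine ⟨hpos c', ?_⟩
  refine (Matrix.det_ne_zero_iff_linearIndepOn_range A.col c'.injective).trans ?_
  rw [← hA, h3]
  refine ⟨fun h => h.isBase_of_rk_le ?_, fun h => h.indep⟩
  rw [rk_ground, hr, hcr]
  simp

theorem IsPosRep.isPositroid [LinearOrder α] (hf : M.Finite) (hr : M.eRank = (r : ℕ))
    (h : M.IsPosRep (· < ·) r v) : M.IsPositroid := by
  have hrk : M.rk M.E = r := by rw [rk_ground, hr]; simp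
  let A : Matrix (Fin r) M.E ℝ := Matrix.of fun i x => v x.1 i
  -- for sets of size `r`
  have key : ∀ J : Set M.E, J.ncard = r →
      (LinearIndepOn ℝ A.col J ↔ M.IsBase (Subtype.val '' J)) := by
    intro J hJ
    have := hf.ground_finite.to_subtype
    obtain ⟨c, hc, hcJ⟩ := exists_increasing_enumeration (· < ·) r J J.toFinite hJ
    have h1 := (h (fun i => (c i).1) (fun i => (c i).2) fun i j hij => hc i j hij).2
    rw [← hcJ, ← range_comp, ← Matrix.det_ne_zero_iff_linearIndepOn_range _
      (injective_of_increasing (· < ·) (· < ·) c (hc _ _))]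
    exact h1
  have hbase : ∀ B, M.IsBase B → ∃ J : Set M.E, Subtype.val '' J = B ∧ J.ncard = r ∧
      LinearIndepOn ℝ A.col J := by
    intro B hB
    have h1 : Subtype.val '' ((Subtype.val : M.E → α) ⁻¹' B) = B := by
      rw [Subtype.image_preimage_coe, inter_eq_right]
      exact hB.subset_ground
    have h2 : ((Subtype.val : M.E → α) ⁻¹' B).ncard = r := by
      rw [← ncard_image_of_injective _ Subtype.val_injective, h1, hB.ncard_eq_rk, hrk]
    exact ⟨_, h1, h2, (key _ h2).2 (by rwa [h1])⟩
  refine ⟨hf, r, A, hr, fun I => ⟨fun hI => ?_, fun hI => ?_⟩, fun c => ?_⟩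
  · obtain ⟨B, hB, hIB⟩ := hI.exists_isBase_superset
    obtain ⟨J, rfl, -, hJ⟩ := hbase B hB
    exact hJ.mono ((image_subset_image_iff Subtype.val_injective).1 hIB)
  · obtain ⟨B₀, hB₀⟩ := M.exists_isBase
    obtain ⟨J₀, -, hJ₀c, hJ₀⟩ := hbase B₀ hB₀
    -- The maximal extension `J` spans all columns, hence the whole space, because the columns of a
    -- basis of `M` do. So `J` has `r` elements and `key` applies.
    obtain ⟨J, -, hIJ, hJ, hJi⟩ := exists_linearIndepOn_extension hI (subset_univ I)
    have hs : Submodule.span ℝ (A.col '' J) = ⊤ := by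
      have := hf.ground_finite.to_subtype
      have h1 : Submodule.span ℝ (A.col '' J₀) = ⊤ := by
        have h2 : LinearIndependent ℝ (fun x : J₀ => A.col x) := hJ₀
        have := Fintype.ofFinite J₀
        have h3 := h2.span_eq_top_of_card_eq_finrank' (by
          rw [Module.finrank_fin_fun, ← hJ₀c, ← Nat.card_eq_fintype_card]; rfl)
        rwa [image_eq_range]
      rw [eq_top_iff, ← h1]
      exact Submodule.span_le.2 ((image_mono (subset_univ J₀)).trans hJ)
    exact ((key J (hJi.ncard_eq_of_span_eq_top hs)).1 hJi).indep.subset (image_mono hIJ)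
  · exact (h (fun i => (c i).1) (fun i => (c i).2) fun i j hij => c.strictMono hij).1

theorem coe_finRotate_pow {n k : ℕ} (hk : k ≤ n + 1) (i : Fin (n + 1)) :
    ((finRotate (n + 1) ^ k) i).1 = if i.1 + k < n + 1 then i.1 + k else i.1 + k - (n + 1) := by
  induction k with
  | zero =>
    have := i.2
    rw [pow_zero, Equiv.Perm.one_apply, if_pos (by omega), add_zero]
  | succ k ih =>
    have ih := ih (by omega)
    rw [pow_succ', Equiv.Perm.mul_apply, coe_finRotate]
    have hi := i.2
    have : ((finRotate (n + 1) ^ k) i) = Fin.last n ↔ ((finRotate (n + 1) ^ k) i).1 = n := by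
      rw [Fin.ext_iff]; rfl
    split_ifs at * <;> grind

/-- Positive realizability is preserved when the initial segment `¬ p` of the order is moved
to its end. -/
theorem IsPosRep.rotate {lt' : α → α → Prop} [IsStrictTotalOrder α lt] {p : α → Prop}
    [DecidablePred p] (hs : ∀ a b, (p a ↔ p b) → lt' a b → lt a b)
    (hlt : ∀ a b, ¬ p a → p b → lt a b ∧ ¬ lt' a b) (h : M.IsPosRep lt r v) :
    M.IsPosRep lt' r (fun x i => (if p x then (-1) ^ (r + 1) else 1) * v x i) := by
  intro c hcE hc
  obtain _ | n := r
  · have := h c hcE fun i => i.elim0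
    simpa using this
  obtain ⟨k, hk, hkp⟩ := Fin.exists_forall_iff_lt (fun i => p (c i)) (fun i j hij hj => by
    by_contra hi
    exact (hlt _ _ hi hj).2 (hc i j hij))
  -- The entries with `p` occupy the first `k` places of `c`. Rotating by `k` puts them last, which
  -- makes the sequence increasing for `lt`.
  set σ := finRotate (n + 1) ^ k with hσ
  have hdet : (Matrix.of fun i j => (if p (c j) then (-1) ^ (n + 1 + 1) else 1) * v (c j) i).det =
      (Matrix.of fun i j => v (c (σ j)) i).det := by
    have h1 := Matrix.det_mul_row (fun j => if p (c j) then (-1 : ℝ) ^ (n + 1 + 1) else 1)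
      (Matrix.of fun i j => v (c j) i)
    have h2 := Matrix.det_permute' σ (Matrix.of fun i j => v (c j) i)
    -- A cycle of length `n + 1` has sign `(-1) ^ n`, so each of the `k` rotations is compensated by
    -- one rescaled column.
    have h3 : (∏ j, if p (c j) then (-1 : ℝ) ^ (n + 1 + 1) else 1) =
        ((Equiv.Perm.sign σ : ℤˣ) : ℤ) := by
      rw [hσ, map_pow, sign_finRotate]
      simp only [hkp]
      rw [Finset.prod_ite, Finset.prod_const_one, mul_one, Finset.prod_const,
        Fin.card_filter_val_lt, min_eq_right hk]
      push_cast
      congr 1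
      rw [pow_succ, pow_succ]
      simp
    rw [h3, ← h2] at h1
    exact h1
  have hr : range (fun j => c (σ j)) = range c := σ.surjective.range_comp c
  rw [hdet, ← hr]
  refine h _ (fun i => hcE _) fun i j hij => ?_
  have h1 := coe_finRotate_pow hk i
  have h2 := coe_finRotate_pow hk j
  rw [← hσ] at h1 h2
  have hij' : i.1 < j.1 := hij
  have hj := j.2
  by_cases hi : p (c (σ i))
  · have hi' := (hkp _).1 hi
    have h3 : (σ j).1 < k := by split_ifs at h1 h2 <;> omega
    refine hs _ _ ⟨fun _ => (hkp _).2 h3, fun _ => hi⟩ (hc _ _ ?_)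
    rw [Fin.lt_def]
    split_ifs at h1 h2 <;> omega
  · have hi' := mt (hkp (σ i)).2 hi
    by_cases hj' : p (c (σ j))
    · exact (hlt _ _ hi hj').1
    · have hj'' := mt (hkp (σ j)).2 hj'
      refine hs _ _ ⟨fun h => absurd h hi, fun h => absurd h hj'⟩ (hc _ _ ?_)
      rw [Fin.lt_def]
      split_ifs at h1 h2 <;> omega

theorem IsPosRep.shift [LinearOrder α] (w : α) (h : M.IsPosRep (· < ·) r v) :
    ∃ v', M.IsPosRep (ShiftLT w) r v' := by
  refine ⟨_, h.rotate (p := fun x => w ≤ x) ?_ ?_⟩ <;> intro a b <;> unfold ShiftLT <;> grind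

theorem IsPosRep.unshift [LinearOrder α] {w : α} (h : M.IsPosRep (ShiftLT w) r v) :
    ∃ v', M.IsPosRep (· < ·) r v' := by
  refine ⟨_, h.rotate (p := fun x => x < w) ?_ ?_⟩ <;> intro a b <;> unfold ShiftLT <;> grind

/-- A positive realization can be normalized at an element with a fixed position in the
increasing enumerations of the bases containing it. -/
theorem IsPosRep.exists_single [IsStrictTotalOrder α lt] [M.Finite] (h : M.IsPosRep lt r v)
    (hr : M.rk M.E = r) {e : α} (he : M.Indep {e}) (i₀ : Fin r)
    (hi₀ : ∀ c : Fin r → α, (∀ i, c i ∈ M.E) → (∀ i j, i < j → lt (c i) (c j)) →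
      e ∈ range c → c i₀ = e) :
    ∃ v', M.IsPosRep lt r v' ∧ v' e = Pi.single i₀ 1 := by
  obtain ⟨B, hB, heB⟩ := he.exists_isBase_superset
  rw [singleton_subset_iff] at heB
  obtain ⟨c, hc, rfl⟩ := exists_increasing_enumeration lt r B hB.indep.finite_of_finite
    (hB.ncard_eq_rk.trans hr)
  have hcE : ∀ i, c i ∈ M.E := fun i => hB.subset_ground (mem_range_self i)
  -- Row operations by the inverse of this basis matrix multiply all minors by a positive number and
  -- turn its column `i₀`, which is `v e`, into a unit vector.
  set W := Matrix.of fun i j => v (c j) i with hW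
  have hW0 : W.det ≠ 0 := (h c hcE hc).2.2 hB
  have hWpos : 0 < W.det := lt_of_le_of_ne (h c hcE hc).1 hW0.symm
  have hG : 0 < W⁻¹.det := by
    rw [Matrix.det_nonsing_inv, Ring.inverse_eq_inv']
    exact inv_pos.2 hWpos
  refine ⟨fun x => W⁻¹.mulVec (v x), fun c' hc'E hc' => ?_, ?_⟩
  · have h1 : (Matrix.of fun i j => W⁻¹.mulVec (v (c' j)) i) =
        W⁻¹ * Matrix.of fun i j => v (c' j) i := by
      ext i j
      rfl
    have h2 := h c' hc'E hc'
    rw [h1, Matrix.det_mul, mul_ne_zero_iff_left hG.ne']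
    exact ⟨mul_nonneg hG.le h2.1, h2.2⟩
  · have h1 : v e = W.mulVec (Pi.single i₀ 1) := by
      rw [Matrix.mulVec_single_one, ← hi₀ c hcE hc heB]
      rfl
    simp only [h1, Matrix.mulVec_mulVec]
    rw [Matrix.nonsing_inv_mul _ (isUnit_iff_ne_zero.2 hW0), Matrix.one_mulVec]

end PosRep

end Matroid

/-! ## The 2-sum of positroids is a positroid -/

namespace Matrix

theorem det_of_split_lower {N k l : ℕ} (h : N = k + l) (A : Matrix (Fin N) (Fin N) ℝ)
    (hz : ∀ i j : Fin N, k ≤ i.1 → j.1 < k → A i j = 0) :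
    A.det = (of fun i j : Fin k => A ⟨i, by omega⟩ ⟨j, by omega⟩).det *
      (of fun i j : Fin l => A ⟨k + i, by omega⟩ ⟨k + j, by omega⟩).det := by
  subst h
  rw [← det_submatrix_equiv_self finSumFinEquiv A, ← fromBlocks_toBlocks (A.submatrix _ _)]
  have : (A.submatrix (finSumFinEquiv (m := k) (n := l)) finSumFinEquiv).toBlocks₂₁ = 0 := by
    ext i j
    exact hz _ _ (by simp) (by simp)
  rw [this, det_fromBlocks_zero₂₁]
  rfl

theorem det_of_split_upper {N k l : ℕ} (h : N = k + l) (A : Matrix (Fin N) (Fin N) ℝ)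
    (hz : ∀ i j : Fin N, i.1 < k → k ≤ j.1 → A i j = 0) :
    A.det = (of fun i j : Fin k => A ⟨i, by omega⟩ ⟨j, by omega⟩).det *
      (of fun i j : Fin l => A ⟨k + i, by omega⟩ ⟨k + j, by omega⟩).det := by
  subst h
  rw [← det_submatrix_equiv_self finSumFinEquiv A, ← fromBlocks_toBlocks (A.submatrix _ _)]
  have : (A.submatrix (finSumFinEquiv (m := k) (n := l)) finSumFinEquiv).toBlocks₁₂ = 0 := by
    ext i j
    exact hz _ _ (by simp) (by simp)
  rw [this, det_fromBlocks_zero₁₂]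
  rfl

theorem det_cons_single {α : Type*} {n : ℕ} (f : α → Fin (n + 1) → ℝ) {e : α}
    (he : f e = Pi.single 0 1) (c : Fin n → α) :
    (of fun i j => f ((Fin.cons e c : Fin (n + 1) → α) j) i).det =
      (of fun i j : Fin n => f (c j) i.succ).det := by
  rw [det_succ_column_zero, Fin.sum_univ_succ, Finset.sum_eq_zero]
  · simp only [Fin.val_zero, pow_zero, of_apply, Fin.cons_zero, he, Pi.single_eq_same, one_mul,
      add_zero, Fin.succAbove_zero]
    rfl
  · intro i _
    simp [he]

theorem det_snoc_single {α : Type*} {n : ℕ} (f : α → Fin (n + 1) → ℝ) {e : α}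
    (he : f e = Pi.single (Fin.last n) 1) (c : Fin n → α) :
    (of fun i j => f ((Fin.snoc c e : Fin (n + 1) → α) j) i).det =
      (of fun i j : Fin n => f (c j) i.castSucc).det := by
  rw [det_succ_column _ (Fin.last n), Fin.sum_univ_castSucc, Finset.sum_eq_zero]
  · simp only [Fin.val_last, of_apply, Fin.snoc_last, he, Pi.single_eq_same, mul_one, zero_add,
      Fin.succAbove_last, Even.neg_one_pow (Even.add_self n), one_mul]
    congr 1
    ext i j
    simp
  · intro i _
    simp [he]

end Matrix

namespace Matroid

/-! ### Gluing two positive realizations along the basepoint -/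

section Glue

variable {α : Type*} {P Q : Matroid α} {e : α}

/-- The rank of the 2-sum is `r(P) + r(Q) - 1`, so the two independent sets describing a basis must
both be bases. -/
theorem TwoSummable.isBase_iff (h : TwoSummable e P Q) {X : Set α}
    (hX : X ⊆ (P.E ∪ Q.E) \ {e}) :
    (twoSum e P Q).IsBase X ↔ (P.IsBase (X ∩ P.E) ∧ Q.IsBase (insert e (X ∩ Q.E))) ∨
      (P.IsBase (insert e (X ∩ P.E)) ∧ Q.IsBase (X ∩ Q.E)) := by
  have := h.finite_left
  have := h.finite_right
  have := h.finite
  have heX : e ∉ X := fun h => (hX h).2 rfl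
  have hXPQ : X = X ∩ P.E ∪ X ∩ Q.E := by
    rw [← inter_union_distrib_left, eq_comm, inter_eq_left]
    exact hX.trans sdiff_subset
  have hrk : (twoSum e P Q).rk (twoSum e P Q).E + 1 = P.rk P.E + Q.rk Q.E := by
    have := h.rk_union_sdiff (Subset.rfl : P.E \ {e} ⊆ P.E \ {e})
    rwa [insert_sdiff_self_of_mem h.mem_left, ← union_sdiff_distrib, ← h.ground_eq] at this
  have hback : ∀ A B, P.IsBase A → Q.IsBase B → ((e ∈ A ∧ e ∉ B) ∨ (e ∉ A ∧ e ∈ B)) →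
      X = (A ∪ B) \ {e} → (twoSum e P Q).IsBase X := by
    rintro A B hA hB he rfl
    have hc := TwoSumIndep.ncard h hA.indep hB.indep he
    rw [hA.ncard_eq_rk, hB.ncard_eq_rk] at hc
    exact (h.indep_iff.2 ⟨A, B, hA.indep, hB.indep, he, rfl⟩).isBase_of_rk_le (by omega)
  constructor
  · intro hb
    obtain ⟨A, B, hA, hB, he, hAB⟩ := h.indep_iff.1 hb.indep
    have hMN : ∀ x, x ∈ P.E → x ∈ Q.E → x = e := fun x hx hx' => by
      rw [← mem_singleton_iff, ← h.inter_eq]; exact ⟨hx, hx'⟩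
    have hc := TwoSumIndep.ncard h hA hB he
    rw [← hAB, hb.ncard_eq_rk, hrk] at hc
    have h1 := hA.ncard_le_rk hA.subset_ground
    have h2 := hB.ncard_le_rk hB.subset_ground
    have hAb := hA.isBase_of_rk_le (by omega)
    have hBb := hB.isBase_of_rk_le (by omega)
    have hXA : X ∩ P.E = A \ {e} := by
      ext x
      have := hMN x
      have : x ∈ A → x ∈ P.E := fun hx => hA.subset_ground hx
      have : x ∈ B → x ∈ Q.E := fun hx => hB.subset_ground hx
      rw [hAB]
      simp only [mem_inter_iff, mem_sdiff, mem_union, mem_singleton_iff]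
      tauto
    have hXB : X ∩ Q.E = B \ {e} := by
      ext x
      have := hMN x
      have : x ∈ A → x ∈ P.E := fun hx => hA.subset_ground hx
      have : x ∈ B → x ∈ Q.E := fun hx => hB.subset_ground hx
      rw [hAB]
      simp only [mem_inter_iff, mem_sdiff, mem_union, mem_singleton_iff]
      tauto
    rw [hXA, hXB]
    rcases he with ⟨he, he'⟩ | ⟨he, he'⟩
    · rw [insert_sdiff_self_of_mem he, sdiff_singleton_eq_self he']
      exact Or.inr ⟨hAb, hBb⟩
    · rw [insert_sdiff_self_of_mem he', sdiff_singleton_eq_self he]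
      exact Or.inl ⟨hAb, hBb⟩
  · rintro (⟨hA, hB⟩ | ⟨hA, hB⟩)
    · refine hback _ _ hA hB (Or.inr ⟨fun h => heX h.1, mem_insert _ _⟩) ?_
      rw [union_insert, ← hXPQ, insert_sdiff_self_of_notMem heX]
    · refine hback _ _ hA hB (Or.inl ⟨mem_insert _ _, fun h => heX h.1⟩) ?_
      rw [insert_union, ← hXPQ, insert_sdiff_self_of_notMem heX]

open Classical in
/-- The vectors of the 2-sum: the last coordinate on the right side and the first coordinate on the
left side are identified. -/
noncomputable def glue (Q : Matroid α) {m n : ℕ} (vQ : α → Fin (m + 1) → ℝ)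
    (vP : α → Fin (n + 1) → ℝ) (x : α) (i : Fin (m + 1 + n)) : ℝ :=
  if x ∈ Q.E then (if h : i.1 < m + 1 then vQ x ⟨i, h⟩ else 0)
  else (if h : m ≤ i.1 then vP x ⟨i - m, by omega⟩ else 0)

/-- Columns of `Q` live in rows `0, …, m` and columns of `P` in rows `m, …, m + n`. A maximal minor
with `k` columns from `Q`, which come first, is block triangular. It can be nonzero only for `k = m`
or `k = m + 1`, the two kinds of bases of the 2-sum. In the square blocks missing row `m`, the
column of `e` is restored without a sign, because `e` is last for `ltQ` and first for `lt`. -/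
theorem TwoSummable.isPosRep_glue (h : TwoSummable e P Q) {lt ltQ : α → α → Prop}
    [IsStrictTotalOrder α lt] {m n : ℕ} {vQ : α → Fin (m + 1) → ℝ} {vP : α → Fin (n + 1) → ℝ}
    (hP : P.IsPosRep lt (n + 1) vP) (hQ : Q.IsPosRep ltQ (m + 1) vQ)
    (hPe : vP e = Pi.single 0 1) (hQe : vQ e = Pi.single (Fin.last m) 1)
    (hPr : P.rk P.E = n + 1) (hQr : Q.rk Q.E = m + 1)
    (heP : ∀ x ∈ P.E, x ≠ e → lt e x) (heQ : ∀ x ∈ Q.E, x ≠ e → ltQ x e)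
    (hltQ : ∀ x ∈ Q.E, ∀ y ∈ Q.E, x ≠ e → y ≠ e → lt x y → ltQ x y)
    (hQP : ∀ p ∈ P.E, ∀ q ∈ Q.E, p ≠ e → q ≠ e → lt q p) :
    (twoSum e P Q).IsPosRep lt (m + 1 + n) (glue Q vQ vP) := by
  intro c hcE hc
  rw [h.ground_eq] at hcE
  have hMN : ∀ x, x ∈ P.E → x ∈ Q.E → x = e := fun x hx hx' => by
    rw [← mem_singleton_iff, ← h.inter_eq]; exact ⟨hx, hx'⟩
  have hce : ∀ i, c i ≠ e := fun i => (hcE i).2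
  obtain ⟨k, hk, hkQ⟩ := Fin.exists_forall_iff_lt (fun i => c i ∈ Q.E) (fun i j hij hj => by
    by_contra hi
    exact asymm (hc i j hij) (hQP _ ((hcE i).1.resolve_right hi) _ hj (hce i) (hce j)))
  obtain ⟨l, hl⟩ := Nat.exists_eq_add_of_le hk
  have hkP : ∀ i, c i ∈ P.E ↔ k ≤ i.1 := fun i => by
    rw [← not_lt, ← hkQ]
    exact ⟨fun hi hi' => hce i (hMN _ hi hi'), fun hi => (hcE i).1.resolve_right hi⟩
  let c₁ : Fin k → α := fun i => c ⟨i, by omega⟩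
  let c₂ : Fin l → α := fun i => c ⟨k + i, by omega⟩
  have hc₁ : ∀ i j, i < j → lt (c₁ i) (c₁ j) := fun i j hij => hc _ _ hij
  have hc₂ : ∀ i j, i < j → lt (c₂ i) (c₂ j) := fun i j hij =>
    hc _ _ (Fin.mk_lt_mk.2 (Nat.add_lt_add_left hij k))
  have hc₁Q : ∀ i, c₁ i ∈ Q.E := fun i => (hkQ _).2 i.2
  have hc₂P : ∀ i, c₂ i ∈ P.E := fun i => (hkP _).2 (by simp)
  have hr₁ : range c ∩ Q.E = range c₁ := by
    ext x
    constructor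
    · rintro ⟨⟨i, rfl⟩, hi⟩
      exact ⟨⟨i, (hkQ i).1 hi⟩, rfl⟩
    · rintro ⟨i, rfl⟩
      exact ⟨⟨_, rfl⟩, hc₁Q i⟩
  have hr₂ : range c ∩ P.E = range c₂ := by
    ext x
    constructor
    · rintro ⟨⟨i, rfl⟩, hi⟩
      have := (hkP i).1 hi
      exact ⟨⟨i - k, by omega⟩, congrArg c (Fin.ext (by simp; omega))⟩
    · rintro ⟨i, rfl⟩
      exact ⟨⟨_, rfl⟩, hc₂P i⟩
  have hn₁ := ncard_range_of_increasing hc₁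
  have hn₂ := ncard_range_of_increasing hc₂
  have he₁ : e ∉ range c₁ := by rintro ⟨i, hi⟩; exact hce _ hi
  have he₂ : e ∉ range c₂ := by rintro ⟨i, hi⟩; exact hce _ hi
  have hbase := h.isBase_iff (X := range c) (by rintro _ ⟨i, rfl⟩; exact hcE i)
  rw [hr₁, hr₂] at hbase
  have hn₁' := ncard_insert_of_notMem he₁ (finite_range c₁)
  have hn₂' := ncard_insert_of_notMem he₂ (finite_range c₂)
  have b₁ : Q.IsBase (range c₁) → k = m + 1 := fun h => by
    have := h.ncard_eq_rk; omega
  have b₂ : P.IsBase (range c₂) → l = n + 1 := fun h => by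
    have := h.ncard_eq_rk; omega
  have b₁' : Q.IsBase (insert e (range c₁)) → k = m := fun h => by
    have := h.ncard_eq_rk; omega
  have b₂' : P.IsBase (insert e (range c₂)) → l = n := fun h => by
    have := h.ncard_eq_rk; omega
  set A := Matrix.of fun i j => glue Q vQ vP (c j) i with hA
  have hAQ : ∀ i j : Fin (m + 1 + n), j.1 < k →
      A i j = if h : i.1 < m + 1 then vQ (c j) ⟨i, h⟩ else 0 := fun i j hj => by
    rw [hA, Matrix.of_apply, glue, if_pos ((hkQ j).2 hj)]
  have hAP : ∀ i j : Fin (m + 1 + n), k ≤ j.1 →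
      A i j = if h : m ≤ i.1 then vP (c j) ⟨i - m, by omega⟩ else 0 := fun i j hj => by
    rw [hA, Matrix.of_apply, glue, if_neg (fun h => absurd ((hkQ j).1 h) (by omega))]
  -- the degenerate cases
  have hdeg : A.det = 0 → k ≠ m → k ≠ m + 1 →
      0 ≤ A.det ∧ (A.det ≠ 0 ↔ (twoSum e P Q).IsBase (range c)) := by
    intro h0 h1 h2
    refine ⟨h0.ge, fun h' => absurd h0 h', fun hb => ?_⟩
    rcases hbase.1 hb with ⟨-, hb⟩ | ⟨-, hb⟩
    · exact absurd (b₁' hb) h1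
    · exact absurd (b₁ hb) h2
  rcases lt_or_ge k (m + 1) with hkm | hkm
  · have hdet := Matrix.det_of_split_upper hl A fun i j hi hj => by
      rw [hAP i j hj, dif_neg (by omega)]
    obtain hkm | rfl := lt_or_eq_of_le (Nat.lt_succ_iff.1 hkm)
    · refine hdeg ?_ (by omega) (by omega)
      rw [hdet, Matrix.det_eq_zero_of_row_eq_zero (A := Matrix.of _) (⟨0, by omega⟩ : Fin l),
        mul_zero]
      intro j
      rw [Matrix.of_apply, hAP _ _ (by simp), dif_neg (by simpa using hkm)]
    -- Row `m` goes to `P`: the minor is that of the chosen columns of `Q` followed by `e`, times a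
    -- full minor of `P`.
    · obtain rfl : l = n + 1 := by omega
      have h1 : (Matrix.of fun i j : Fin k => A ⟨i, by omega⟩ ⟨j, by omega⟩) =
          Matrix.of fun i j : Fin k => vQ (c₁ j) i.castSucc := by
        ext i j
        rw [Matrix.of_apply, hAQ _ _ j.2, dif_pos (by have := i.2; simp)]
        rfl
      have h2 : (Matrix.of fun i j : Fin (n + 1) => A ⟨k + i, by omega⟩ ⟨k + j, by omega⟩) =
          Matrix.of fun i j => vP (c₂ j) i := by
        ext i j
        rw [Matrix.of_apply, hAP _ _ (by simp), dif_pos (by simp), Matrix.of_apply]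
        congr 1
        ext
        simp
      rw [h1, h2, ← Matrix.det_snoc_single vQ hQe] at hdet
      have k1 := hQ (Fin.snoc c₁ e) (Fin.lastCases (by simpa using h.mem_right)
        fun i => by simpa using hc₁Q i) (fun i j => by
          refine Fin.lastCases (fun h => absurd h (not_lt.2 (Fin.le_last _))) (fun i => ?_) i
          refine Fin.lastCases (fun _ => ?_) (fun j h => ?_) j
          · simpa using heQ _ (hc₁Q i) (hce _)
          · simpa using hltQ _ (hc₁Q i) _ (hc₁Q j) (hce _) (hce _) (hc₁ i j (by simpa using h)))
      have k2 := hP c₂ hc₂P hc₂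
      rw [Fin.range_snoc] at k1
      rw [hdet, hbase, mul_ne_zero_iff, k1.2, k2.2]
      refine ⟨mul_nonneg k1.1 k2.1, fun h => Or.inl h.symm, ?_⟩
      rintro (h | h)
      · exact h.symm
      · have := b₁ h.2
        omega
  · have hdet := Matrix.det_of_split_lower hl A fun i j hi hj => by
      rw [hAQ i j hj, dif_neg (by omega)]
    obtain hkm | rfl := lt_or_eq_of_le hkm
    · refine hdeg ?_ (by omega) (by omega)
      rw [hdet, Matrix.det_eq_zero_of_row_eq_zero (A := Matrix.of _) (⟨m + 1, by omega⟩ : Fin k),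
        zero_mul]
      intro j
      rw [Matrix.of_apply, hAQ _ _ j.2, dif_neg (by simp)]
    -- Row `m` goes to `Q`: the minor is a full minor of `Q` times that of `e` followed by the
    -- chosen columns of `P`.
    · obtain rfl : l = n := by omega
      have h1 : (Matrix.of fun i j : Fin (m + 1) => A ⟨i, by omega⟩ ⟨j, by omega⟩) =
          Matrix.of fun i j => vQ (c₁ j) i := by
        ext i j
        rw [Matrix.of_apply, hAQ _ _ j.2, dif_pos i.2]
        rfl
      have h2 : (Matrix.of fun i j : Fin l => A ⟨m + 1 + i, by omega⟩ ⟨m + 1 + j, by omega⟩) =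
          Matrix.of fun i j : Fin l => vP (c₂ j) i.succ := by
        ext i j
        rw [Matrix.of_apply, hAP _ _ (by simp), dif_pos (by simp; omega), Matrix.of_apply]
        congr 1
        ext
        simp
        omega
      rw [h1, h2, ← Matrix.det_cons_single vP hPe] at hdet
      have k1 := hQ c₁ hc₁Q fun i j hij =>
        hltQ _ (hc₁Q i) _ (hc₁Q j) (hce _) (hce _) (hc₁ i j hij)
      have k2 := hP (Fin.cons e c₂) (Fin.cases (by simpa using h.mem_left)
        fun i => by simpa using hc₂P i) (fun i j => by
          refine Fin.cases (fun h => absurd h (Fin.not_lt_zero _)) (fun j => ?_) j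
          refine Fin.cases (fun _ => ?_) (fun i h => ?_) i
          · simpa using heP _ (hc₂P j) (hce _)
          · simpa using hc₂ i j (by simpa using h))
      rw [Fin.range_cons] at k2
      rw [hdet, hbase, mul_ne_zero_iff, k1.2, k2.2]
      refine ⟨mul_nonneg k1.1 k2.1, fun h => Or.inr h.symm, ?_⟩
      rintro (h | h)
      · have := b₂ h.1
        omega
      · exact h.symm

end Glue

section TwoSumPositroid

variable {α : Type*} [LinearOrder α] {P Q : Matroid α} {e : α}

/-- Two non-crossing sets that share one element are, from that element on, one after the other. -/
theorem _root_.NonCrossing.forall_shiftLT {E F : Set α} (hEF : NonCrossing E F)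
    (he : E ∩ F = {e}) :
    (∀ p ∈ E, ∀ q ∈ F, p ≠ e → q ≠ e → ShiftLT e q p) ∨
      (∀ p ∈ E, ∀ q ∈ F, p ≠ e → q ≠ e → ShiftLT e p q) := by
  have heE : e ∈ E := (he.symm ▸ mem_singleton e : e ∈ E ∩ F).1
  have heF : e ∈ F := (he.symm ▸ mem_singleton e : e ∈ E ∩ F).2
  have hd : ∀ x ∈ E, ∀ y ∈ F, x ≠ e → x ≠ y := fun x hx y hy hxe hxy => by
    apply hxe
    rw [← mem_singleton_iff, ← he]
    exact ⟨hx, hxy ▸ hy⟩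
  by_contra hcon
  push Not at hcon
  obtain ⟨⟨p₁, hp₁, q₁, hq₁, hp₁e, hq₁e, h1⟩, p₂, hp₂, q₂, hq₂, hp₂e, hq₂e, h2⟩ := hcon
  have d1 := hd p₁ hp₁ q₁ hq₁ hp₁e
  have d2 := hd p₂ hp₂ q₂ hq₂ hp₂e
  have d3 := hd p₂ hp₂ q₁ hq₁ hp₂e
  -- From `e` on, `p₁` precedes `q₁` and `q₂` precedes `p₂`. The first quadruple alternates if `q₁`
  -- precedes `p₂`, the second one otherwise.
  have x1 := fun h => hEF ⟨p₁, hp₁, q₁, hq₁, p₂, hp₂, e, heF, h⟩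
  have x2 := fun h => hEF ⟨e, heE, q₂, hq₂, p₂, hp₂, q₁, hq₁, h⟩
  clear hd
  unfold ShiftLT at *
  grind

theorem TwoSummable.isPositroid_of_shiftLT (h : TwoSummable e P Q) (hP : P.IsPositroid)
    (hQ : Q.IsPositroid) (hQP : ∀ p ∈ P.E, ∀ q ∈ Q.E, p ≠ e → q ≠ e → ShiftLT e q p) :
    (twoSum e P Q).IsPositroid := by
  have := h.finite_left
  have := h.finite_right
  have := h.finite
  obtain ⟨rP, vP, hrP, hvP⟩ := hP.exists_isPosRep
  obtain ⟨rQ, vQ, hrQ, hvQ⟩ := hQ.exists_isPosRep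
  have hPr : P.rk P.E = rP := by rw [rk_ground, hrP]; simp
  have hQr : Q.rk Q.E = rQ := by rw [rk_ground, hrQ]; simp
  have h1 := h.rk_singleton
  have h2 := P.rk_mono (singleton_subset_iff.2 h.mem_left)
  have h3 := h.symm.rk_singleton
  have h4 := Q.rk_mono (singleton_subset_iff.2 h.mem_right)
  obtain ⟨n, rfl⟩ : ∃ n, rP = n + 1 := ⟨rP - 1, by omega⟩
  obtain ⟨m, rfl⟩ : ∃ m, rQ = m + 1 := ⟨rQ - 1, by omega⟩
  -- the first element of the right side after `e`
  obtain ⟨q₀, hq₀, hq₀e⟩ := h.symm.exists_mem_ne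
  obtain ⟨q, ⟨hq, hqe⟩, hqmin⟩ := exists_minimal_of_finite (ShiftLT e)
    (Q.ground_finite.subset (sdiff_subset : Q.E \ {e} ⊆ Q.E)) ⟨q₀, hq₀, hq₀e⟩
  simp only [mem_singleton_iff] at hqe
  have heP : ∀ x, x ≠ e → ShiftLT e e x := fun x hx => by unfold ShiftLT; grind
  have heQ : ∀ x ∈ Q.E, x ≠ e → ShiftLT q x e := fun x hx hxe => by
    have := hqmin x ⟨hx, hxe⟩
    unfold ShiftLT at *
    grind
  have hltQ : ∀ x ∈ Q.E, ∀ y ∈ Q.E, x ≠ e → y ≠ e → ShiftLT e x y → ShiftLT q x y := by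
    intro x hx y hy hxe hye hxy
    have h1 := hqmin x ⟨hx, hxe⟩
    have h2 := hqmin y ⟨hy, hye⟩
    unfold ShiftLT at *
    grind
  -- Reading `P` from `e` makes `e` its first element. Reading `Q` from the successor `q` of `e`
  -- makes `e` its last element and keeps the order of the others.
  obtain ⟨vP', hvP'⟩ := hvP.shift e
  obtain ⟨vQ', hvQ'⟩ := hvQ.shift q
  obtain ⟨uP, huP, huPe⟩ := hvP'.exists_single hPr h.indep_left 0 (by
    rintro c - hc ⟨i, hi⟩
    by_contra h0
    rcases eq_or_ne i 0 with rfl | hi0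
    · exact h0 hi
    · exact asymm (hc 0 i (Fin.pos_iff_ne_zero.2 hi0)) (hi ▸ heP _ h0))
  obtain ⟨uQ, huQ, huQe⟩ := hvQ'.exists_single hQr h.indep_right (Fin.last m) (by
    rintro c hcE hc ⟨i, hi⟩
    by_contra h0
    rcases eq_or_ne i (Fin.last m) with rfl | hi0
    · exact h0 hi
    · exact asymm (hc i _ (Fin.lt_last_iff_ne_last.2 hi0)) (hi ▸ heQ _ (hcE _) h0))
  obtain ⟨v, hv⟩ := (h.isPosRep_glue huP huQ huPe huQe hPr hQr (fun x _ => heP x) heQ hltQ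
    hQP).unshift
  refine hv.isPositroid h.finite ?_
  have hrk := h.rk_union_sdiff (Subset.rfl : P.E \ {e} ⊆ P.E \ {e})
  rw [insert_sdiff_self_of_mem h.mem_left, ← union_sdiff_distrib, ← h.ground_eq] at hrk
  rw [← eRk_ground, ← coe_rk]
  exact_mod_cast (by omega : (twoSum e P Q).rk (twoSum e P Q).E = m + 1 + n)

theorem TwoSummable.isPositroid (h : TwoSummable e P Q) (hP : P.IsPositroid) (hQ : Q.IsPositroid)
    (hPQ : NonCrossing P.E Q.E) : (twoSum e P Q).IsPositroid := by
  rcases hPQ.forall_shiftLT h.inter_eq with h' | h'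
  · exact h.isPositroid_of_shiftLT hP hQ h'
  · rw [h.twoSum_comm]
    exact h.symm.isPositroid_of_shiftLT hQ hP fun p hp q hq hpe hqe => h' q hq p hp hqe hpe

end TwoSumPositroid

end Matroid

/-! ### The envelope class of a 2-sum -/

theorem mainTheorem4 {α : Type*} [LinearOrder α] (P Q : Matroid α) (e : α)
    (hP : P.IsPositroid) (hQ : Q.IsPositroid)
    (hPc : P.IsNConnected 2) (hQc : Q.IsNConnected 2)
    (hPcard : 3 ≤ P.E.ncard) (hQcard : 3 ≤ Q.E.ncard)
    (hcross : NonCrossing P.E Q.E) (he : P.E ∩ Q.E = {e}) :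
    Matroid.TwoSummable e P Q ∧
    (∀ M ∈ P.envelopeClass, ∀ N ∈ Q.envelopeClass, Matroid.TwoSummable e M N) ∧
    (Matroid.twoSum e P Q).envelopeClass =
      {R | ∃ M ∈ P.envelopeClass, ∃ N ∈ Q.envelopeClass, R = Matroid.twoSum e M N} := by
  -- Connectivity enters only here, to keep `{e}` from being a 1-separation of either matroid.
  have h : Matroid.TwoSummable e P Q := ⟨hP.1, hQ.1, by omega, by omega, he,
    hPc 1 le_rfl (by norm_num) _, hQc 1 le_rfl (by norm_num) _⟩
  have h2 : ∀ M ∈ P.envelopeClass, ∀ N ∈ Q.envelopeClass, Matroid.TwoSummable e M N := by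
    intro M hM N hN
    rw [Matroid.mem_envelopeClass_iff hP] at hM
    rw [Matroid.mem_envelopeClass_iff hQ] at hN
    exact h.of_rk_eq hM.1 hN.1 hM.2.1 hN.2.1 hM.2.2 hN.2.2
  refine ⟨h, h2, ?_⟩
  ext R
  rw [Matroid.mem_envelopeClass_iff (h.isPositroid hP hQ hcross), h.ground_eq]
  simp only [mem_ofPred_eq]
  constructor
  · rintro ⟨hRf, hRE, hR⟩
    obtain ⟨M, N, hM, hN, hPM, hQN, hPr, hQr, hMN⟩ :=
      h.exists_eq_twoSum hcross hRf hRE.symm hR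
    exact ⟨M, (Matroid.mem_envelopeClass_iff hP).2 ⟨hM, hPM, hPr⟩, N,
      (Matroid.mem_envelopeClass_iff hQ).2 ⟨hN, hQN, hQr⟩, hMN⟩
  · rintro ⟨M, hM, N, hN, rfl⟩
    have h' := h2 M hM N hN
    rw [Matroid.mem_envelopeClass_iff hP] at hM
    rw [Matroid.mem_envelopeClass_iff hQ] at hN
    refine ⟨h'.finite, by rw [h'.ground_eq, hM.2.1, hN.2.1], fun I hI => ?_⟩
    exact h.rk_arc_eq h' hM.2.1 hN.2.1 hcross hM.2.2 hN.2.2 hI
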